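/- **Setting.** Let $k$ be a commutative ring, $L$ an associative unital $k$-algebra, $G$ a group, $T_\alpha$ ($\alpha\in G$) $k$-algebra automorphisms of $L$ with $T_\alpha\circ T_{\alpha^{-1}}=\mathrm{id}_L$, $X$ a finite set, $\deg\colon X\to G$ a map, and $\sigma=(\sigma^{ab}_{cd})_{a,b,c,d\in X}$ a family of elements of $L$. Let $A_\sigma$ be the $k$-algebra generated by the algebra $L\otimes_kL^{op}$ (with its addition, scalar multiplication, product and unit) and symbols $L_{ab}$, $(L^{-1})_{ab}$ ($a,b\in X$), subject to the relations, for all $a,b,c,d\in X$ and $f\in L$, $$\sum_cL_{ac}(L^{-1})_{cb}=\delta_{ab}=\sum_c(L^{-1})_{ac}L_{cb},$$ $$(T_{\deg(a)}(f)\otimes1)L_{ab}=L_{ab}(f\otimes1),\qquad (1\otimes T_{\deg(b)}(f))L_{ab}=L_{ab}(1\otimes f),$$ $$(f\otimes1)(L^{-1})_{ab}=(L^{-1})_{ab}(T_{\deg(b)}(f)\otimes1),\qquad (1\otimes f)(L^{-1})_{ab}=(L^{-1})_{ab}(1\otimes T_{\deg(a)}(f)),$$ $$\sum_{x,y}(\sigma^{xy}_{ac}\otimes1)L_{yd}L_{xb}=\sum_{x,y}(1\otimes\sigma^{bd}_{xy})L_{cy}L_{ax}.$$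 Put $s_L(l)=l\otimes1$ and $t_L(l)=1\otimes l$, and let $A\otimes_LA$ (for $A=A_\sigma$) be formed with the actions $a\cdot l=t_L(l)a$ and $l\cdot a=s_L(l)a$. We say that $\sigma$ satisfies the right bialgebroid condition if, for all $a,b,c,d\in X$ and $f\in L$, $$T_{\deg(a)^{-1}}T_{\deg(c)^{-1}}(\sigma^{bd}_{ac}f)=T_{\deg(b)^{-1}}T_{\deg(d)^{-1}}(f\sigma^{bd}_{ac}),$$ and that $\sigma$ is rigid if there are $x_{ab},y_{ab}\in A_\sigma$ with $$\sum_c(L^{-1})_{cb}x_{ac}=\sum_cx_{cb}(L^{-1})_{ac}=\sum_cL_{cb}y_{ac}=\sum_cy_{cb}L_{ac}=\delta_{ab}1\quad(a,b\in X).$$ Let $\Delta_L\colon A_\sigma\to A_\sigma\otimes_LA_\sigma$ be the $k$-linear map induced by the algebra homomorphism from the free algebra on the generators to $A_\sigma\otimes_kA_\sigma$ with $l\otimes l'\mapsto s_L(l)\otimes t_L(l')$, $L_{ab}\mapsto\sum_cL_{ac}\otimes L_{cb}$, $(L^{-1})_{ab}\mapsto\sum_c(L^{-1})_{cb}\otimes(L^{-1})_{ac}$.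 Let $\pi_L(a)=\varepsilon(a)(1_L)$, where (under the right bialgebroid condition) $\varepsilon\colon A_\sigma\to\mathrm{End}_k(L)$ is the algebra homomorphism with $\varepsilon(l\otimes l')(g)=lgl'$, $\varepsilon(L_{ab})=\delta_{ab}T_{\deg(a)}$, $\varepsilon((L^{-1})_{ab})=\delta_{ab}T_{\deg(a)^{-1}}$. **Theorem.** Let $\sigma$ be rigid and satisfy the right bialgebroid condition. Then there is a $k$-algebra anti-automorphism $S$ of $A=A_\sigma$ with $$S(s_L(f))=t_L(f),\quad S(t_L(f))=s_L(f)\ (f\in L),\quad S(L_{ab})=(L^{-1})_{ab}\ (a,b\in X),$$ and for every such $S$ the pair consisting of $(A,L,s_L,t_L,\Delta_L,\pi_L)$ and $S$ is a Hopf algebroid in the sense of Böhm–Szlachányi. That is, for every ring $L'$ and every ring isomorphism $\nu\colon L^{op}\to L'$: 1. $(A,L,s_L,t_L,\Delta_L,\pi_L)$ is a left bialgebroid: with $l\cdot a\cdot l'=s_L(l)t_L(l')a$, $(A,\Delta_L,\pi_L)$ is a comonoid in $L$-bimodules, and, writing $\Delta_L(a)=a_{(1)}\otimes a_{(2)}$,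 one has $a_{(1)}t_L(l)\otimes a_{(2)}=a_{(1)}\otimes a_{(2)}s_L(l)$, $\Delta_L(1)=1\otimes1$, $\Delta_L(ab)=\Delta_L(a)\Delta_L(b)$, $\pi_L(1)=1$, and $\pi_L(as_L(\pi_L(b)))=\pi_L(ab)=\pi_L(at_L(\pi_L(b)))$. 2. $S\circ t_L=s_L$, and $S(a_{(1)})a_{(2)}=t_L\pi_LS(a)$ for all $a\in A$. 3. Let $A\otimes_{L'}A$ be formed with the actions $a\cdot r=aS(s_L(\nu^{-1}(r)))$ and $r\cdot a=as_L(\nu^{-1}(r))$, let $S_{A\otimes_LA}\colon A\otimes_LA\to A\otimes_{L'}A$ be the map $a\otimes b\mapsto S(b)\otimes S(a)$, and put $\Delta_{L'}=S_{A\otimes_LA}\circ\Delta_L\circ S^{-1}$. Then the maps in the following identities are well defined (that is, $\Delta_L$ is compatible with the left and right $L'$-actions and $\Delta_{L'}$ with the left and right $L$-actions), and $$(\Delta_L\otimes\mathrm{id})\circ\Delta_{L'}=(\mathrm{id}\otimes\Delta_{L'})\circ\Delta_L,\qquad(\Delta_{L'}\otimes\mathrm{id})\circ\Delta_L=(\mathrm{id}\otimes\Delta_L)\circ\Delta_{L'}.$$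 4. The map $S_{A\otimes_{L'}A}\colon A\otimes_{L'}A\to A\otimes_LA$, $a\otimes b\mapsto S(b)\otimes S(a)$, is well defined and invertible, and $S_{A\otimes_LA}\circ\Delta_L\circ S^{-1}=S_{A\otimes_{L'}A}^{-1}\circ\Delta_L\circ S$. -/

import Mathlib

open scoped TensorProduct
open MulOpposite

set_option linter.unusedSectionVars false

noncomputable section

/-! ### Tensor products over a noncommutative ring

Let `M` be a right and `N` a left module over a ring `R`, the two actions being given by
`k`-linear operators `ρ r : M → M` and `lam r : N → N`. -/

section Balanced

variable {k R Q M N P M' N' : Type*} [CommRing k]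
  [AddCommGroup M] [Module k M] [AddCommGroup N] [Module k N] [AddCommGroup P] [Module k P]
  [AddCommGroup M'] [Module k M'] [AddCommGroup N'] [Module k N']

/-- The submodule of `M ⊗ₖ N` spanned by all `(m · r) ⊗ n - m ⊗ (r · n)`. -/
def balancedRel (ρ : R → Module.End k M) (lam : R → Module.End k N) :
    Submodule k (M ⊗[k] N) :=
  Submodule.span k {z | ∃ r m n, z = (ρ r m) ⊗ₜ[k] n - m ⊗ₜ[k] (lam r n)}

/-- The tensor product `M ⊗_R N`, as the quotient of `M ⊗ₖ N` by the balancing relations. -/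
def BalTensor (ρ : R → Module.End k M) (lam : R → Module.End k N) : Type _ :=
  (M ⊗[k] N) ⧸ balancedRel ρ lam

instance (ρ : R → Module.End k M) (lam : R → Module.End k N) :
    AddCommGroup (BalTensor ρ lam) :=
  inferInstanceAs (AddCommGroup ((M ⊗[k] N) ⧸ balancedRel ρ lam))

instance (ρ : R → Module.End k M) (lam : R → Module.End k N) :
    Module k (BalTensor ρ lam) :=
  inferInstanceAs (Module k ((M ⊗[k] N) ⧸ balancedRel ρ lam))

namespace BalTensor

variable (ρ : R → Module.End k M) (lam : R → Module.End k N)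

/-- The quotient map `M ⊗ₖ N → M ⊗_R N`. -/
def mk : M ⊗[k] N →ₗ[k] BalTensor ρ lam := (balancedRel ρ lam).mkQ

theorem mk_surjective : Function.Surjective (mk ρ lam) :=
  Submodule.mkQ_surjective _

/-- The pure tensor `m ⊗ n` in `M ⊗_R N`. -/
abbrev tmul (m : M) (n : N) : BalTensor ρ lam := mk ρ lam (m ⊗ₜ[k] n)

theorem tmul_balanced (r : R) (m : M) (n : N) :
    tmul ρ lam (ρ r m) n = tmul ρ lam m (lam r n) := by
  refine (Submodule.Quotient.eq _).2 (Submodule.subset_span ⟨r, m, n, rfl⟩)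

variable {ρ lam}

/-- The map `M ⊗_R N → P` induced by a balanced `k`-bilinear map. -/
def lift (f : M →ₗ[k] N →ₗ[k] P) (hf : ∀ r m n, f (ρ r m) n = f m (lam r n)) :
    BalTensor ρ lam →ₗ[k] P :=
  (balancedRel ρ lam).liftQ (TensorProduct.lift f) (by
    refine Submodule.span_le.2 ?_
    rintro _ ⟨r, m, n, rfl⟩
    simp [hf])

@[simp] theorem lift_tmul (f : M →ₗ[k] N →ₗ[k] P)
    (hf : ∀ r m n, f (ρ r m) n = f m (lam r n)) (m : M) (n : N) :
    lift f hf (tmul ρ lam m n) = f m n :=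
  TensorProduct.lift.tmul m n

/-- The map `f ⊗ g : M ⊗_R N → M' ⊗_R N'` induced by `R`-linear maps `f` and `g`. -/
def map {ρ' : R → Module.End k M'} {lam' : R → Module.End k N'}
    (f : M →ₗ[k] M') (g : N →ₗ[k] N')
    (hf : ∀ r m, f (ρ r m) = ρ' r (f m)) (hg : ∀ r n, g (lam r n) = lam' r (g n)) :
    BalTensor ρ lam →ₗ[k] BalTensor ρ' lam' :=
  lift (((TensorProduct.mk k M' N').compr₂ (mk ρ' lam')).compl₁₂ f g) (by
    intro r m n
    simp only [LinearMap.compl₁₂_apply, LinearMap.compr₂_apply, TensorProduct.mk_apply, hf, hg]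
    exact tmul_balanced ρ' lam' r (f m) (g n))

@[simp] theorem map_tmul {ρ' : R → Module.End k M'} {lam' : R → Module.End k N'}
    (f : M →ₗ[k] M') (g : N →ₗ[k] N')
    (hf : ∀ r m, f (ρ r m) = ρ' r (f m)) (hg : ∀ r n, g (lam r n) = lam' r (g n))
    (m : M) (n : N) :
    map f g hf hg (tmul ρ lam m n) = tmul ρ' lam' (f m) (g n) := by
  simp [map]

/-- The map `f ⊗ id : M ⊗_R N → M' ⊗_R N`. -/
def mapFst (ρ' : R → Module.End k M') (f : M →ₗ[k] M') (hf : ∀ r m, f (ρ r m) = ρ' r (f m)) :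
    BalTensor ρ lam →ₗ[k] BalTensor ρ' lam :=
  map f LinearMap.id hf (fun _ _ => rfl)

/-- The map `id ⊗ g : M ⊗_R N → M ⊗_R N'`. -/
def mapSnd (lam' : R → Module.End k N') (g : N →ₗ[k] N')
    (hg : ∀ r n, g (lam r n) = lam' r (g n)) :
    BalTensor ρ lam →ₗ[k] BalTensor ρ lam' :=
  map LinearMap.id g (fun _ _ => rfl) hg

/-- The operator `f ⊗ id` on `M ⊗_R N`, for an operator `f` on `M` commuting with `R`. -/
def actFst (f : Module.End k M) (hf : ∀ r m, f (ρ r m) = ρ r (f m)) :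
    Module.End k (BalTensor ρ lam) :=
  mapFst ρ f hf

/-- The operator `id ⊗ g` on `M ⊗_R N`, for an operator `g` on `N` commuting with `R`. -/
def actSnd (g : Module.End k N) (hg : ∀ r n, g (lam r n) = lam r (g n)) :
    Module.End k (BalTensor ρ lam) :=
  mapSnd lam g hg

/-- The canonical map `(M ⊗_R N) ⊗_Q P → M ⊗_R (N ⊗_Q P)`,
`(m ⊗ n) ⊗ p ↦ m ⊗ (n ⊗ p)`, for an `R`-`Q`-bimodule `N`. -/
def assoc (ρ₁ : R → Module.End k M) (lam₁ : R → Module.End k N)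
    (ρ₂ : Q → Module.End k N) (lam₂ : Q → Module.End k P)
    (h : ∀ r q n, lam₁ r (ρ₂ q n) = ρ₂ q (lam₁ r n)) :
    BalTensor (M := BalTensor ρ₁ lam₁)
        (fun q => actSnd (ρ₂ q) (fun r n => (h r q n).symm)) lam₂ →ₗ[k]
      BalTensor (N := BalTensor ρ₂ lam₂) ρ₁
        (fun r => actFst (lam₁ r) (fun q n => h r q n)) :=
  lift
    (lift
      ((LinearMap.llcomp k P (BalTensor ρ₂ lam₂) _).compl₁₂
        ((TensorProduct.mk k M (BalTensor ρ₂ lam₂)).compr₂ (mk _ _))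
        ((TensorProduct.mk k N P).compr₂ (mk ρ₂ lam₂)))
      (by
        intro r m n
        ext p
        have := tmul_balanced ρ₁ (fun r => actFst (lam₁ r) (fun q n => h r q n)) r m
          (tmul ρ₂ lam₂ n p)
        simp only [actFst, mapFst, map_tmul] at this
        exact this))
    (by
      intro q z p
      obtain ⟨z, rfl⟩ := mk_surjective _ _ z
      induction z using TensorProduct.induction_on with
      | zero => simp
      | add x y hx hy => simp only [map_add, LinearMap.add_apply, hx, hy]
      | tmul m n =>
        have := tmul_balanced ρ₂ lam₂ q n p
        simp only [actSnd, mapSnd, map_tmul, lift_tmul]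
        exact congrArg (tmul ρ₁ (fun r => actFst (lam₁ r) (fun q n => h r q n)) m) this)

theorem assoc_tmul (ρ₁ : R → Module.End k M) (lam₁ : R → Module.End k N)
    (ρ₂ : Q → Module.End k N) (lam₂ : Q → Module.End k P)
    (h : ∀ r q n, lam₁ r (ρ₂ q n) = ρ₂ q (lam₁ r n)) (m : M) (n : N) (p : P) :
    assoc ρ₁ lam₁ ρ₂ lam₂ h (tmul _ _ (tmul _ _ m n) p) = tmul _ _ m (tmul _ _ n p) := by
  simp only [assoc, lift_tmul]
  rfl

end BalTensor

end Balanced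

/-! ### Left bialgebroids and Hopf algebroids

Everything is done for algebras over a commutative ring `k`; rings are the case `k = ℤ`. -/

/-- Source and target maps `s : L → A`, `t : Lᵒᵖ → A` with commuting images. -/
structure SourceTarget (k A L : Type*) [CommRing k] [Ring A] [Algebra k A]
    [Ring L] [Algebra k L] where
  s : L →ₐ[k] A
  t : Lᵐᵒᵖ →ₐ[k] A
  comm : ∀ l l' : L, s l * t (op l') = t (op l') * s l

section Bialgebroid

variable {k A L L' : Type*} [CommRing k] [Ring A] [Algebra k A] [Ring L] [Algebra k L] [Ring L']

namespace SourceTarget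

variable (B : SourceTarget k A L)

/-- The left action `l · a = s(l) a` of `L` on `A`. -/
def lact (l : L) : Module.End k A := LinearMap.mulLeft k (B.s l)

/-- The right action `a · l = t(l) a` of `L` on `A`. -/
def ract (l : L) : Module.End k A := LinearMap.mulLeft k (B.t (op l))

/-- The tensor product `A ⊗_L A` for the two actions of `L` by left multiplications. -/
abbrev TensorL : Type _ := BalTensor B.ract B.lact

theorem lact_ract (l l' : L) (a : A) : B.lact l (B.ract l' a) = B.ract l' (B.lact l a) := by
  simp only [lact, ract, LinearMap.mulLeft_apply, ← mul_assoc, B.comm]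

/-- The product `x ↦ x (b ⊗ 1)` on `A ⊗_L A`. -/
abbrev mulRightFst (b : A) : Module.End k B.TensorL :=
  BalTensor.actFst (LinearMap.mulRight k b) (fun _ _ => by simp [ract, mul_assoc])

/-- The product `x ↦ x (1 ⊗ b)` on `A ⊗_L A`. -/
abbrev mulRightSnd (b : A) : Module.End k B.TensorL :=
  BalTensor.actSnd (LinearMap.mulRight k b) (fun _ _ => by simp [lact, mul_assoc])

/-- The left action `l · (a ⊗ b) = s(l) a ⊗ b` of `L` on `A ⊗_L A`. -/
abbrev lactL (l : L) : Module.End k B.TensorL :=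
  BalTensor.actFst (B.lact l) (fun l' a => B.lact_ract l l' a)

/-- The right action `(a ⊗ b) · l = a ⊗ t(l) b` of `L` on `A ⊗_L A`. -/
abbrev ractL (l : L) : Module.End k B.TensorL :=
  BalTensor.actSnd (B.ract l) (fun l' a => (B.lact_ract l' l a).symm)

/-- The kernel of `A ⊗ₖ A → A ⊗_L A`. -/
abbrev relL : Submodule k (A ⊗[k] A) := balancedRel B.ract B.lact

theorem relL_gen (l : L) (p q : A) :
    (B.t (op l) * p) ⊗ₜ[k] q - p ⊗ₜ[k] (B.s l * q) ∈ B.relL :=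
  Submodule.subset_span ⟨l, p, q, rfl⟩

theorem relL_mul (z w : A ⊗[k] A) (hz : z ∈ B.relL) : z * w ∈ B.relL := by
  induction w using TensorProduct.induction_on with
  | zero => simp
  | add x y hx hy => rw [mul_add]; exact add_mem hx hy
  | tmul u v =>
    induction hz using Submodule.span_induction with
    | zero => simp
    | add x y _ _ hx hy => rw [add_mul]; exact add_mem hx hy
    | smul c x _ hx => rw [smul_mul_assoc]; exact Submodule.smul_mem _ _ hx
    | mem x hx =>
      obtain ⟨l, p, q, rfl⟩ := hx
      have := B.relL_gen l (p * u) (q * v)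
      simpa [sub_mul, ract, lact, mul_assoc] using this

/-- Whether left multiplication by `x` preserves the right ideal `relL` can be tested on its
generators. -/
theorem mul_relL (x : A ⊗[k] A)
    (hx : ∀ l, (x * (B.t (op l) ⊗ₜ 1) - x * (1 ⊗ₜ B.s l) : A ⊗[k] A) ∈ B.relL)
    (z : A ⊗[k] A) (hz : z ∈ B.relL) : x * z ∈ B.relL := by
  induction hz using Submodule.span_induction with
  | zero => simp
  | add x y _ _ hx hy => rw [mul_add]; exact add_mem hx hy
  | smul c x _ hx => rw [mul_smul_comm]; exact Submodule.smul_mem _ _ hx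
  | mem z hz =>
    obtain ⟨l, p, q, rfl⟩ := hz
    have := B.relL_mul _ (p ⊗ₜ q) (hx l)
    simpa [mul_assoc, mul_sub, sub_mul, ract, lact] using this

/-- Left multiplication by an element of `A ⊗ₖ A` preserving the balancing relations, as an
operator on `A ⊗_L A`. -/
def mulOp (x : A ⊗[k] A) (hx : ∀ z ∈ B.relL, x * z ∈ B.relL) : Module.End k B.TensorL :=
  (B.relL).mapQ B.relL (LinearMap.mulLeft k x) hx

theorem mulOp_mk (x : A ⊗[k] A) (hx : ∀ z ∈ B.relL, x * z ∈ B.relL) (z : A ⊗[k] A) :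
    B.mulOp x hx (BalTensor.mk _ _ z) = BalTensor.mk _ _ (x * z) :=
  rfl

theorem end_ext {f g : Module.End k B.TensorL}
    (h : ∀ z, f (BalTensor.mk _ _ z) = g (BalTensor.mk _ _ z)) : f = g :=
  LinearMap.ext fun z => by
    obtain ⟨z, rfl⟩ := BalTensor.mk_surjective _ _ z
    exact h z

theorem mulOp_congr {x y : A ⊗[k] A} (hx : ∀ z ∈ B.relL, x * z ∈ B.relL)
    (hy : ∀ z ∈ B.relL, y * z ∈ B.relL) (h : x - y ∈ B.relL) : B.mulOp x hx = B.mulOp y hy :=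
  B.end_ext fun z => by
    rw [mulOp_mk, mulOp_mk, ← sub_eq_zero, ← map_sub, ← sub_mul]
    exact (Submodule.Quotient.mk_eq_zero _).2 (B.relL_mul _ z h)

end SourceTarget

/-- `(A, L, s, t, Δ, π)` is a left bialgebroid. -/
structure IsLeftBialgebroid (B : SourceTarget k A L)
    (Δ : A →ₗ[k] B.TensorL) (π : A →ₗ[k] L) : Prop where
  /-- `Δ` and `π` are maps of `L`-bimodules. -/
  Δ_lact : ∀ l a, Δ (B.lact l a) = B.lactL l (Δ a)
  Δ_ract : ∀ l a, Δ (B.ract l a) = B.ractL l (Δ a)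
  π_lact : ∀ l a, π (B.lact l a) = l * π a
  π_ract : ∀ l a, π (B.ract l a) = π a * l
  /-- `(Δ ⊗ id) Δ = (id ⊗ Δ) Δ`. -/
  coassoc : ∀ a,
    BalTensor.assoc B.ract B.lact B.ract B.lact B.lact_ract
        (BalTensor.mapFst B.ractL Δ Δ_ract (Δ a))
      = BalTensor.mapSnd B.lactL Δ Δ_lact (Δ a)
  /-- `π(a₁) · a₂ = a`, that is, `s(π(a₁)) a₂ = a`. -/
  counit_left : ∀ a,
    BalTensor.lift ((LinearMap.mul k A).comp (B.s.toLinearMap.comp π))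
      (fun l x y => by
        simp only [LinearMap.comp_apply, π_ract]
        simp [SourceTarget.lact, mul_assoc]) (Δ a) = a
  /-- `a₁ · π(a₂) = a`, that is, `t(π(a₂)) a₁ = a`. -/
  counit_right : ∀ a,
    BalTensor.lift ((LinearMap.mul k A).flip.compl₂
        (B.t.toLinearMap.comp ((opLinearEquiv k).toLinearMap.comp π)))
      (fun l x y => by
        simp only [LinearMap.compl₂_apply, LinearMap.comp_apply, π_lact]
        simp [SourceTarget.ract, mul_assoc]) (Δ a) = a
  /-- `a₁ t(l) ⊗ a₂ = a₁ ⊗ a₂ s(l)`. -/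
  takeuchi : ∀ l a, B.mulRightFst (B.t (op l)) (Δ a) = B.mulRightSnd (B.s l) (Δ a)
  Δ_one : Δ 1 = BalTensor.tmul _ _ 1 1
  /-- `Δ(ab) = Δ(a) Δ(b)`; the factorwise product is computed on arbitrary representatives
  in `A ⊗ₖ A`, on which it does not depend because of `takeuchi`. -/
  Δ_mul : ∀ a b, ∀ x y : A ⊗[k] A,
    BalTensor.mk _ _ x = Δ a → BalTensor.mk _ _ y = Δ b → Δ (a * b) = BalTensor.mk _ _ (x * y)
  π_one : π 1 = 1
  π_mul_s : ∀ a b, π (a * B.s (π b)) = π (a * b)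
  π_mul_t : ∀ a b, π (a * B.t (op (π b))) = π (a * b)

/-- An anti-automorphism `S : A ≃ Aᵒᵖ`, as a `k`-linear map from `A` to itself. -/
def antiMap (S : A ≃ₐ[k] Aᵐᵒᵖ) : A →ₗ[k] A :=
  (opLinearEquiv k).symm.toLinearMap.comp S.toLinearMap

/-- The inverse of an anti-automorphism, as a `k`-linear map. -/
def antiInv (S : A ≃ₐ[k] Aᵐᵒᵖ) : A →ₗ[k] A :=
  S.symm.toLinearMap.comp (opLinearEquiv k).toLinearMap

@[simp] theorem antiMap_mul (S : A ≃ₐ[k] Aᵐᵒᵖ) (a b : A) :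
    antiMap S (a * b) = antiMap S b * antiMap S a := by
  simp [antiMap]

@[simp] theorem antiMap_antiInv (S : A ≃ₐ[k] Aᵐᵒᵖ) (a : A) : antiMap S (antiInv S a) = a := by
  simp [antiMap, antiInv]

@[simp] theorem antiInv_antiMap (S : A ≃ₐ[k] Aᵐᵒᵖ) (a : A) : antiInv S (antiMap S a) = a := by
  simp [antiMap, antiInv]

namespace SourceTarget

variable (B : SourceTarget k A L) (S : A ≃ₐ[k] Aᵐᵒᵖ) (ν : Lᵐᵒᵖ ≃+* L')

/-- The left action `r · a = a s(ν⁻¹(r))` of `L'` on `A`. -/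
def lact' (r : L') : Module.End k A := LinearMap.mulRight k (B.s (unop (ν.symm r)))

/-- The right action `a · r = a S(s(ν⁻¹(r)))` of `L'` on `A`. -/
def ract' (r : L') : Module.End k A :=
  LinearMap.mulRight k (antiMap S (B.s (unop (ν.symm r))))

/-- The tensor product `A ⊗_{L'} A`. -/
abbrev TensorL' : Type _ := BalTensor (B.ract' S ν) (B.lact' ν)

theorem lact_ract' (l : L) (r : L') (a : A) :
    B.lact l (B.ract' S ν r a) = B.ract' S ν r (B.lact l a) := by
  simp [lact, ract', mul_assoc]

theorem lact'_lact (l : L) (r : L') (a : A) :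
    B.lact' ν r (B.lact l a) = B.lact l (B.lact' ν r a) := by
  simp [lact, lact', mul_assoc]

theorem lact'_ract (r : L') (l : L) (a : A) :
    B.lact' ν r (B.ract l a) = B.ract l (B.lact' ν r a) := by
  simp [ract, lact', mul_assoc]

theorem ract'_ract (r : L') (l : L) (a : A) :
    B.ract' S ν r (B.ract l a) = B.ract l (B.ract' S ν r a) := by
  simp [ract, ract', mul_assoc]

/-- The left action of `L'` on `A ⊗_L A` through the first factor. -/
abbrev lact'L (r : L') : Module.End k B.TensorL :=
  BalTensor.actFst (B.lact' ν r) (fun l a => B.lact'_ract ν r l a)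

/-- The right action of `L'` on `A ⊗_L A` through the second factor. -/
abbrev ract'L (r : L') : Module.End k B.TensorL :=
  BalTensor.actSnd (B.ract' S ν r) (fun l a => (B.lact_ract' S ν l r a).symm)

/-- The left action of `L` on `A ⊗_{L'} A` through the first factor. -/
abbrev lactL' (l : L) : Module.End k (B.TensorL' S ν) :=
  BalTensor.actFst (B.lact l) (fun r a => B.lact_ract' S ν l r a)

/-- The right action of `L` on `A ⊗_{L'} A` through the second factor. -/
abbrev ractL' (l : L) : Module.End k (B.TensorL' S ν) :=
  BalTensor.actSnd (B.ract l) (fun r a => (B.lact'_ract ν r l a).symm)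

/-- If `S ∘ t = s`, the map `A ⊗_L A → A ⊗_{L'} A`, `a ⊗ b ↦ S(b) ⊗ S(a)`. -/
def twistL (hS : ∀ l, antiMap S (B.t (op l)) = B.s l) : B.TensorL →ₗ[k] B.TensorL' S ν :=
  BalTensor.lift
    (((TensorProduct.mk k A A).compr₂ (BalTensor.mk _ _)).compl₁₂ (antiMap S) (antiMap S)).flip
    (by
      intro l a b
      have := BalTensor.tmul_balanced (B.ract' S ν) (B.lact' ν) (ν (op l))
        (antiMap S b) (antiMap S a)
      simp only [ract', lact', RingEquiv.symm_apply_apply, unop_op,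
        LinearMap.mulRight_apply] at this
      simp only [LinearMap.flip_apply, LinearMap.compl₁₂_apply, LinearMap.compr₂_apply,
        TensorProduct.mk_apply, ract, lact, LinearMap.mulLeft_apply, antiMap_mul, hS]
      exact this.symm)

theorem twistL_tmul (hS : ∀ l, antiMap S (B.t (op l)) = B.s l) (a b : A) :
    B.twistL S ν hS (BalTensor.tmul _ _ a b)
      = BalTensor.tmul _ _ (antiMap S b) (antiMap S a) := by
  simp [twistL]

/-- The map `Δ_{L'}`, that is, `Δ_L` conjugated by `S`. -/
def Δ' (hS : ∀ l, antiMap S (B.t (op l)) = B.s l) (Δ : A →ₗ[k] B.TensorL) :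
    A →ₗ[k] B.TensorL' S ν :=
  (B.twistL S ν hS).comp (Δ.comp (antiInv S))

end SourceTarget

/-- The left bialgebroid `(A, L, s, t, Δ, π)` and the anti-automorphism `S` of `A` form a Hopf
algebroid (`ν : Lᵒᵖ ≅ L'` being the identification used to form `A ⊗_{L'} A`). -/
structure IsHopfAlgebroid (B : SourceTarget k A L) (Δ : A →ₗ[k] B.TensorL) (π : A →ₗ[k] L)
    (S : A ≃ₐ[k] Aᵐᵒᵖ) (ν : Lᵐᵒᵖ ≃+* L') : Prop extends IsLeftBialgebroid B Δ π where
  /-- `S ∘ t = s`. -/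
  S_t : ∀ l, antiMap S (B.t (op l)) = B.s l
  /-- `S(a₁) a₂ = t(π(S(a)))`. -/
  S_mul : ∀ a,
    BalTensor.lift ((LinearMap.mul k A).comp (antiMap S))
      (fun l x y => by
        simp only [SourceTarget.ract, SourceTarget.lact, LinearMap.comp_apply,
          LinearMap.mulLeft_apply, antiMap_mul, S_t, LinearMap.mul_apply', mul_assoc]) (Δ a)
      = B.t (op (π (antiMap S a)))
  /-- `Δ` is `L'`-linear and `Δ'` is `L`-linear on both sides, as is needed for the composites in
  the two mixed coassociativity laws to make sense. -/
  Δ_lact' : ∀ r a, Δ (B.lact' ν r a) = B.lact'L ν r (Δ a)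
  Δ_ract' : ∀ r a, Δ (B.ract' S ν r a) = B.ract'L S ν r (Δ a)
  Δ'_lact : ∀ l a, B.Δ' S ν S_t Δ (B.lact l a) = B.lactL' S ν l (B.Δ' S ν S_t Δ a)
  Δ'_ract : ∀ l a, B.Δ' S ν S_t Δ (B.ract l a) = B.ractL' S ν l (B.Δ' S ν S_t Δ a)
  /-- `(Δ ⊗ id) Δ' = (id ⊗ Δ') Δ` in `A ⊗_L A ⊗_{L'} A`. -/
  coassoc_left : ∀ a,
    BalTensor.assoc B.ract B.lact (B.ract' S ν) (B.lact' ν) (B.lact_ract' S ν)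
        (BalTensor.mapFst (B.ract'L S ν) Δ Δ_ract' (B.Δ' S ν S_t Δ a))
      = BalTensor.mapSnd (B.lactL' S ν) (B.Δ' S ν S_t Δ) Δ'_lact (Δ a)
  /-- `(Δ' ⊗ id) Δ = (id ⊗ Δ) Δ'` in `A ⊗_{L'} A ⊗_L A`. -/
  coassoc_right : ∀ a,
    BalTensor.assoc (B.ract' S ν) (B.lact' ν) B.ract B.lact (B.lact'_ract ν)
        (BalTensor.mapFst (B.ractL' S ν) (B.Δ' S ν S_t Δ) Δ'_ract (Δ a))
      = BalTensor.mapSnd (B.lact'L ν) Δ Δ_lact' (B.Δ' S ν S_t Δ a)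
  /-- The map `A ⊗_{L'} A → A ⊗_L A`, `a ⊗ b ↦ S(b) ⊗ S(a)`, is well defined and invertible,
  and its inverse takes `Δ(S(a))` to `Δ'(a)`. -/
  twist_inv : ∃ E : B.TensorL' S ν ≃ₗ[k] B.TensorL,
    (∀ a b, E (BalTensor.tmul _ _ a b) = BalTensor.tmul _ _ (antiMap S b) (antiMap S a)) ∧
    ∀ a, B.Δ' S ν S_t Δ a = E.symm (Δ (antiMap S a))

end Bialgebroid

/-! ### The algebra `A_σ` -/

/-- The generators: the elements of `L ⊗ₖ Lᵒᵖ` and the symbols `L_{ab}`, `(L⁻¹)_{ab}`. -/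
inductive Gen (k L X : Type*) [CommRing k] [Ring L] [Algebra k L] where
  | base (ξ : L ⊗[k] Lᵐᵒᵖ) : Gen k L X
  | gen (a b : X) : Gen k L X
  | inv (a b : X) : Gen k L X

section Sigma

variable {k L G X : Type*} [CommRing k] [Ring L] [Algebra k L] [Fintype X] [DecidableEq X]

namespace FreeGen

/-- `ξ ∈ L ⊗ₖ Lᵒᵖ` as a generator of the free algebra. -/
abbrev base (X : Type*) (ξ : L ⊗[k] Lᵐᵒᵖ) : FreeAlgebra k (Gen k L X) :=
  FreeAlgebra.ι k (Gen.base ξ)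

/-- The generator `L_{ab}`. -/
abbrev gen (k L : Type*) {X : Type*} [CommRing k] [Ring L] [Algebra k L] (a b : X) :
    FreeAlgebra k (Gen k L X) :=
  FreeAlgebra.ι k (Gen.gen a b)

/-- The generator `(L⁻¹)_{ab}`. -/
abbrev inv (k L : Type*) {X : Type*} [CommRing k] [Ring L] [Algebra k L] (a b : X) :
    FreeAlgebra k (Gen k L X) :=
  FreeAlgebra.ι k (Gen.inv a b)

end FreeGen

open FreeGen in
/-- The defining relations of `A_σ`; `σ a b c d` stands for `σ^{ab}_{cd}`. -/
inductive SigmaRel (T : G → L ≃ₐ[k] L) (deg : X → G) (σ : X → X → X → X → L) :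
    FreeAlgebra k (Gen k L X) → FreeAlgebra k (Gen k L X) → Prop
  | base_add (ξ η : L ⊗[k] Lᵐᵒᵖ) :
      SigmaRel T deg σ (base X ξ + base X η) (base X (ξ + η))
  | base_smul (c : k) (ξ : L ⊗[k] Lᵐᵒᵖ) :
      SigmaRel T deg σ (c • base X ξ) (base X (c • ξ))
  | base_mul (ξ η : L ⊗[k] Lᵐᵒᵖ) :
      SigmaRel T deg σ (base X ξ * base X η) (base X (ξ * η))
  | gen_inv (a b : X) :
      SigmaRel T deg σ (∑ c, gen k L a c * inv k L c b) (if a = b then 1 else 0)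
  | inv_gen (a b : X) :
      SigmaRel T deg σ (∑ c, inv k L a c * gen k L c b) (if a = b then 1 else 0)
  | left_gen (f : L) (a b : X) :
      SigmaRel T deg σ (base X (T (deg a) f ⊗ₜ 1) * gen k L a b)
        (gen k L a b * base X (f ⊗ₜ 1))
  | right_gen (f : L) (a b : X) :
      SigmaRel T deg σ (base X (1 ⊗ₜ op (T (deg b) f)) * gen k L a b)
        (gen k L a b * base X (1 ⊗ₜ op f))
  | left_inv (f : L) (a b : X) :
      SigmaRel T deg σ (base X (f ⊗ₜ 1) * inv k L a b)
        (inv k L a b * base X (T (deg b) f ⊗ₜ 1))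
  | right_inv (f : L) (a b : X) :
      SigmaRel T deg σ (base X (1 ⊗ₜ op f) * inv k L a b)
        (inv k L a b * base X (1 ⊗ₜ op (T (deg a) f)))
  | exchange (a b c d : X) :
      SigmaRel T deg σ
        (∑ x, ∑ y, base X (σ x y a c ⊗ₜ 1) * gen k L y d * gen k L x b)
        (∑ x, ∑ y, base X (1 ⊗ₜ op (σ b d x y)) * gen k L c y * gen k L a x)
  | base_one : SigmaRel T deg σ 1 (base X (1 ⊗ₜ 1))

/-- The algebra `A_σ`: the free algebra modulo the two-sided ideal of the relations. -/
def ASigma (T : G → L ≃ₐ[k] L) (deg : X → G) (σ : X → X → X → X → L) : Type _ :=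
  RingQuot (SigmaRel T deg σ)

instance (T : G → L ≃ₐ[k] L) (deg : X → G) (σ : X → X → X → X → L) : Ring (ASigma T deg σ) :=
  inferInstanceAs (Ring (RingQuot (SigmaRel T deg σ)))

instance (T : G → L ≃ₐ[k] L) (deg : X → G) (σ : X → X → X → X → L) :
    Algebra k (ASigma T deg σ) :=
  inferInstanceAs (Algebra k (RingQuot (SigmaRel T deg σ)))

namespace ASigma

variable (T : G → L ≃ₐ[k] L) (deg : X → G) (σ : X → X → X → X → L)

/-- The quotient map onto `A_σ`. -/
def proj : FreeAlgebra k (Gen k L X) →ₐ[k] ASigma T deg σ :=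
  RingQuot.mkAlgHom k (SigmaRel T deg σ)

/-- A homomorphism from the free algebra that respects the relations descends to `A_σ`. -/
def desc {C : Type*} [Ring C] [Algebra k C] (f : FreeAlgebra k (Gen k L X) →ₐ[k] C)
    (hf : ∀ x y, SigmaRel T deg σ x y → f x = f y) : ASigma T deg σ →ₐ[k] C :=
  RingQuot.liftAlgHom k (s := SigmaRel T deg σ) ⟨f, fun _ _ h => hf _ _ h⟩

theorem desc_proj {C : Type*} [Ring C] [Algebra k C] (f : FreeAlgebra k (Gen k L X) →ₐ[k] C)
    (hf : ∀ x y, SigmaRel T deg σ x y → f x = f y) (w : FreeAlgebra k (Gen k L X)) :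
    desc T deg σ f hf (proj T deg σ w) = f w :=
  RingQuot.liftAlgHom_mkAlgHom_apply k f (fun _ _ h => hf _ _ h) w

theorem proj_rel {x y : FreeAlgebra k (Gen k L X)} (h : SigmaRel T deg σ x y) :
    proj T deg σ x = proj T deg σ y :=
  RingQuot.mkAlgHom_rel k h

/-- The class of `ξ ∈ L ⊗ₖ Lᵒᵖ` in `A_σ`. -/
def base : L ⊗[k] Lᵐᵒᵖ →ₐ[k] ASigma T deg σ :=
  AlgHom.ofLinearMap
    { toFun := fun ξ => proj T deg σ (FreeGen.base X ξ)
      map_add' := fun ξ η => by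
        rw [← map_add]; exact (proj_rel T deg σ (.base_add ξ η)).symm
      map_smul' := fun c ξ => by
        rw [RingHom.id_apply, ← map_smul]; exact (proj_rel T deg σ (.base_smul c ξ)).symm }
    (by
      have := proj_rel T deg σ (.base_one (T := T) (deg := deg) (σ := σ))
      rw [map_one] at this; exact this.symm)
    (fun ξ η => by
      have := proj_rel T deg σ (.base_mul (T := T) (deg := deg) (σ := σ) ξ η)
      rw [map_mul] at this; exact this.symm)

/-- The class of `L_{ab}` in `A_σ`. -/
def gen (a b : X) : ASigma T deg σ := proj T deg σ (FreeGen.gen k L a b)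

/-- The class of `(L⁻¹)_{ab}` in `A_σ`. -/
def inv (a b : X) : ASigma T deg σ := proj T deg σ (FreeGen.inv k L a b)

/-- The source map `s_L(l) = l ⊗ 1` and the target map `t_L(l) = 1 ⊗ l` of `A_σ`. -/
def sourceTarget : SourceTarget k (ASigma T deg σ) L where
  s := (base T deg σ).comp Algebra.TensorProduct.includeLeft
  t := (base T deg σ).comp Algebra.TensorProduct.includeRight
  comm l l' := by
    simp [← map_mul]

/-! #### The comultiplication -/

section Comul

theorem sum_swap {M : Type*} [AddCommMonoid M] (F : X → X → X → X → M) :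
    ∑ e, ∑ f, ∑ x, ∑ y, F e f x y = ∑ x, ∑ y, ∑ e, ∑ f, F e f x y := by
  calc _ = ∑ e, ∑ x, ∑ f, ∑ y, F e f x y := Finset.sum_congr rfl fun _ _ => Finset.sum_comm
    _ = ∑ x, ∑ e, ∑ f, ∑ y, F e f x y := Finset.sum_comm
    _ = ∑ x, ∑ e, ∑ y, ∑ f, F e f x y :=
      Finset.sum_congr rfl fun _ _ => Finset.sum_congr rfl fun _ _ => Finset.sum_comm
    _ = _ := Finset.sum_congr rfl fun _ _ => Finset.sum_comm

theorem s_gen (f : L) (a b : X) :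
    (sourceTarget T deg σ).s (T (deg a) f) * gen T deg σ a b = gen T deg σ a b * (sourceTarget T deg σ).s f := by
  have := proj_rel T deg σ (.left_gen f a b)
  rwa [map_mul, map_mul] at this

theorem t_gen (f : L) (a b : X) :
    (sourceTarget T deg σ).t (op (T (deg b) f)) * gen T deg σ a b = gen T deg σ a b * (sourceTarget T deg σ).t (op f) := by
  have := proj_rel T deg σ (.right_gen f a b)
  rwa [map_mul, map_mul] at this

theorem s_inv (f : L) (a b : X) :
    (sourceTarget T deg σ).s f * inv T deg σ a b = inv T deg σ a b * (sourceTarget T deg σ).s (T (deg b) f) := by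
  have := proj_rel T deg σ (.left_inv f a b)
  rwa [map_mul, map_mul] at this

theorem t_inv (f : L) (a b : X) :
    (sourceTarget T deg σ).t (op f) * inv T deg σ a b = inv T deg σ a b * (sourceTarget T deg σ).t (op (T (deg a) f)) := by
  have := proj_rel T deg σ (.right_inv f a b)
  rwa [map_mul, map_mul] at this

theorem gen_mul_inv (a b : X) :
    ∑ c, gen T deg σ a c * inv T deg σ c b = if a = b then 1 else 0 := by
  have := proj_rel T deg σ (.gen_inv a b)
  rw [apply_ite (proj T deg σ), map_one, map_zero, map_sum] at this
  simpa only [map_mul, gen, inv] using this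

theorem inv_mul_gen (a b : X) :
    ∑ c, inv T deg σ a c * gen T deg σ c b = if a = b then 1 else 0 := by
  have := proj_rel T deg σ (.inv_gen a b)
  rw [apply_ite (proj T deg σ), map_one, map_zero, map_sum] at this
  simpa only [map_mul, gen, inv] using this

theorem gen_exchange (a b c d : X) :
    ∑ x, ∑ y, (sourceTarget T deg σ).s (σ x y a c) * gen T deg σ y d * gen T deg σ x b =
      ∑ x, ∑ y, (sourceTarget T deg σ).t (op (σ b d x y)) * gen T deg σ c y * gen T deg σ a x := by
  have := proj_rel T deg σ (.exchange a b c d)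
  simp only [map_sum, map_mul] at this
  exact this

/-- The homomorphism from the free algebra to `A_σ ⊗ₖ A_σ` with `l ⊗ l' ↦ s(l) ⊗ t(l')`,
`L_{ab} ↦ ∑ L_{ac} ⊗ L_{cb}`, `(L⁻¹)_{ab} ↦ ∑ (L⁻¹)_{cb} ⊗ (L⁻¹)_{ac}`. -/
def comulBar : FreeAlgebra k (Gen k L X) →ₐ[k] ASigma T deg σ ⊗[k] ASigma T deg σ :=
  FreeAlgebra.lift k fun
    | .base ξ => Algebra.TensorProduct.map (sourceTarget T deg σ).s (sourceTarget T deg σ).t ξ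
    | .gen a b => ∑ c, gen T deg σ a c ⊗ₜ gen T deg σ c b
    | .inv a b => ∑ c, inv T deg σ c b ⊗ₜ inv T deg σ a c

@[simp] theorem comulBar_base (ξ : L ⊗[k] Lᵐᵒᵖ) :
    comulBar T deg σ (FreeGen.base X ξ) = Algebra.TensorProduct.map (sourceTarget T deg σ).s (sourceTarget T deg σ).t ξ := by
  simp [comulBar]

@[simp] theorem comulBar_gen (a b : X) :
    comulBar T deg σ (FreeGen.gen k L a b) = ∑ c, gen T deg σ a c ⊗ₜ gen T deg σ c b := by
  simp [comulBar]

@[simp] theorem comulBar_inv (a b : X) :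
    comulBar T deg σ (FreeGen.inv k L a b) = ∑ c, inv T deg σ c b ⊗ₜ inv T deg σ a c := by
  simp [comulBar]

variable [Group G]

theorem comulBar_mul_relL (hT : ∀ α f, T α (T α⁻¹ f) = f) (w : FreeAlgebra k (Gen k L X)) :
    ∀ z ∈ (sourceTarget T deg σ).relL, comulBar T deg σ w * z ∈ (sourceTarget T deg σ).relL := by
  induction w using FreeAlgebra.induction with
  | grade0 r =>
    intro z hz
    rw [AlgHom.commutes, ← Algebra.smul_def]
    exact Submodule.smul_mem _ _ hz
  | mul a b ha hb =>
    intro z hz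
    rw [map_mul, mul_assoc]
    exact ha _ (hb _ hz)
  | add a b ha hb =>
    intro z hz
    rw [map_add, add_mul]
    exact add_mem (ha _ hz) (hb _ hz)
  | grade1 v =>
    refine (sourceTarget T deg σ).mul_relL _ ?_
    intro l
    cases v with
    | base ξ =>
      rw [comulBar_base]
      induction ξ using TensorProduct.induction_on with
      | zero => simp
      | add x y hx hy =>
        rw [map_add, add_mul, add_mul, add_sub_add_comm]; exact add_mem hx hy
      | tmul f g =>
        have := (sourceTarget T deg σ).relL_gen l ((sourceTarget T deg σ).s f) ((sourceTarget T deg σ).t g)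
        have h1 := (sourceTarget T deg σ).comm f l
        have h2 := (sourceTarget T deg σ).comm l (unop g)
        rw [op_unop] at h2
        simpa [h1, h2] using this
    | gen a b =>
      rw [comulBar_gen, Finset.sum_mul, Finset.sum_mul, ← Finset.sum_sub_distrib]
      refine sum_mem fun c _ => ?_
      have := (sourceTarget T deg σ).relL_gen (T (deg c) l) (gen T deg σ a c) (gen T deg σ c b)
      rw [t_gen, s_gen] at this
      simpa using this
    | inv a b =>
      rw [comulBar_inv, Finset.sum_mul, Finset.sum_mul, ← Finset.sum_sub_distrib]
      refine sum_mem fun c _ => ?_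
      have := (sourceTarget T deg σ).relL_gen (T (deg c)⁻¹ l) (inv T deg σ c b) (inv T deg σ a c)
      rw [t_inv, s_inv, hT] at this
      simpa using this

theorem comulBar_exchange (a b c d : X) :
    comulBar T deg σ
        (∑ x, ∑ y, FreeGen.base X (σ x y a c ⊗ₜ 1) * FreeGen.gen k L y d * FreeGen.gen k L x b)
      - comulBar T deg σ
        (∑ x, ∑ y, FreeGen.base X (1 ⊗ₜ op (σ b d x y)) * FreeGen.gen k L c y
          * FreeGen.gen k L a x) ∈ (sourceTarget T deg σ).relL := by
  have h1 : comulBar T deg σ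
        (∑ x, ∑ y, FreeGen.base X (σ x y a c ⊗ₜ 1) * FreeGen.gen k L y d * FreeGen.gen k L x b)
      = ∑ e, ∑ f, ∑ x, ∑ y, ((sourceTarget T deg σ).t (op (σ f e x y)) * (gen T deg σ c y * gen T deg σ a x)) ⊗ₜ[k]
          (gen T deg σ e d * gen T deg σ f b) := by
    simp only [← mul_assoc, ← TensorProduct.sum_tmul, ← gen_exchange]
    simp only [map_sum, map_mul, comulBar_base, comulBar_gen, Algebra.TensorProduct.map_tmul,
      map_one, Finset.mul_sum, Finset.sum_mul, Algebra.TensorProduct.tmul_mul_tmul, one_mul,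
      TensorProduct.sum_tmul]
    calc _ = ∑ x, ∑ f, ∑ y, ∑ e, ((sourceTarget T deg σ).s (σ x y a c) * gen T deg σ y e * gen T deg σ x f) ⊗ₜ[k]
          (gen T deg σ e d * gen T deg σ f b) := Finset.sum_congr rfl fun x _ => Finset.sum_comm
      _ = ∑ f, ∑ x, ∑ e, ∑ y, ((sourceTarget T deg σ).s (σ x y a c) * gen T deg σ y e * gen T deg σ x f) ⊗ₜ[k]
          (gen T deg σ e d * gen T deg σ f b) := by
        rw [Finset.sum_comm]
        exact Finset.sum_congr rfl fun f _ => Finset.sum_congr rfl fun x _ => Finset.sum_comm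
      _ = ∑ f, ∑ e, ∑ x, ∑ y, ((sourceTarget T deg σ).s (σ x y a c) * gen T deg σ y e * gen T deg σ x f) ⊗ₜ[k]
          (gen T deg σ e d * gen T deg σ f b) := Finset.sum_congr rfl fun x _ => Finset.sum_comm
      _ = _ := Finset.sum_comm
  have h2 : comulBar T deg σ
        (∑ x, ∑ y, FreeGen.base X (1 ⊗ₜ op (σ b d x y)) * FreeGen.gen k L c y
          * FreeGen.gen k L a x)
      = ∑ e, ∑ f, ∑ x, ∑ y, (gen T deg σ c y * gen T deg σ a x) ⊗ₜ[k]
          ((sourceTarget T deg σ).s (σ f e x y) * (gen T deg σ e d * gen T deg σ f b)) := by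
    have h3 : ∀ x y, ∑ e, ∑ f, (gen T deg σ c y * gen T deg σ a x) ⊗ₜ[k]
          ((sourceTarget T deg σ).s (σ f e x y) * (gen T deg σ e d * gen T deg σ f b))
        = ∑ x', ∑ y', (gen T deg σ c y * gen T deg σ a x) ⊗ₜ[k]
          ((sourceTarget T deg σ).t (op (σ b d x' y')) * gen T deg σ y y' * gen T deg σ x x') := by
      intro x y
      rw [Finset.sum_comm]
      simp only [← mul_assoc, ← TensorProduct.tmul_sum]
      rw [gen_exchange T deg σ x b y d]
    rw [sum_swap]
    simp only [h3]
    simp only [map_sum, map_mul, comulBar_base, comulBar_gen, Algebra.TensorProduct.map_tmul,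
      map_one, Finset.mul_sum, Finset.sum_mul, Algebra.TensorProduct.tmul_mul_tmul, one_mul]
    rw [sum_swap]
  rw [h1, h2]
  simp only [← Finset.sum_sub_distrib]
  exact sum_mem fun e _ => sum_mem fun f _ => sum_mem fun x _ => sum_mem fun y _ =>
    (sourceTarget T deg σ).relL_gen _ _ _

theorem comulBar_rel {x y : FreeAlgebra k (Gen k L X)} (h : SigmaRel T deg σ x y) :
    comulBar T deg σ x - comulBar T deg σ y ∈ (sourceTarget T deg σ).relL := by
  have key : comulBar T deg σ x = comulBar T deg σ y →
      comulBar T deg σ x - comulBar T deg σ y ∈ (sourceTarget T deg σ).relL := fun h => by simp [h]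
  cases h with
  | base_add ξ η => exact key (by simp)
  | base_smul c ξ => exact key (by simp)
  | base_mul ξ η => exact key (by simp)
  | gen_inv a b =>
    refine key ?_
    simp only [map_sum, map_mul, comulBar_gen, comulBar_inv, Finset.sum_mul, Finset.mul_sum,
      Algebra.TensorProduct.tmul_mul_tmul]
    rw [Finset.sum_comm]
    have : ∀ e, ∑ c, ∑ f, (gen T deg σ a f * inv T deg σ e b) ⊗ₜ[k]
        (gen T deg σ f c * inv T deg σ c e)
        = (gen T deg σ a e * inv T deg σ e b) ⊗ₜ[k] 1 := by
      intro e
      rw [Finset.sum_comm]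
      simp only [← TensorProduct.tmul_sum, gen_mul_inv]
      simp [TensorProduct.tmul_ite]
    simp only [this, ← TensorProduct.sum_tmul, gen_mul_inv]
    split_ifs <;> simp [Algebra.TensorProduct.one_def]
  | inv_gen a b =>
    refine key ?_
    simp only [map_sum, map_mul, comulBar_gen, comulBar_inv, Finset.sum_mul, Finset.mul_sum,
      Algebra.TensorProduct.tmul_mul_tmul]
    rw [Finset.sum_comm]
    have : ∀ f, ∑ c, ∑ e, (inv T deg σ e c * gen T deg σ c f) ⊗ₜ[k]
        (inv T deg σ a e * gen T deg σ f b)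
        = 1 ⊗ₜ[k] (inv T deg σ a f * gen T deg σ f b) := by
      intro f
      rw [Finset.sum_comm]
      simp only [← TensorProduct.sum_tmul, inv_mul_gen]
      simp [TensorProduct.ite_tmul]
    simp only [this, ← TensorProduct.tmul_sum, inv_mul_gen]
    split_ifs <;> simp [Algebra.TensorProduct.one_def]
  | left_gen f a b => exact key (by simp [Finset.mul_sum, Finset.sum_mul, s_gen])
  | right_gen f a b => exact key (by simp [Finset.mul_sum, Finset.sum_mul, t_gen])
  | left_inv f a b => exact key (by simp [Finset.mul_sum, Finset.sum_mul, s_inv])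
  | right_inv f a b => exact key (by simp [Finset.mul_sum, Finset.sum_mul, t_inv])
  | exchange a b c d => exact comulBar_exchange T deg σ a b c d
  | base_one => exact key (by simp [Algebra.TensorProduct.one_def])

/-- Left multiplication by `comulBar w` as an operator on `A_σ ⊗_L A_σ`. -/
def comulOp (hT : ∀ α f, T α (T α⁻¹ f) = f) :
    FreeAlgebra k (Gen k L X) →ₐ[k] Module.End k (sourceTarget T deg σ).TensorL :=
  AlgHom.ofLinearMap
    { toFun := fun w => (sourceTarget T deg σ).mulOp (comulBar T deg σ w) (comulBar_mul_relL T deg σ hT w)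
      map_add' := fun v w => (sourceTarget T deg σ).end_ext fun z => by
        rw [LinearMap.add_apply]
        simp only [SourceTarget.mulOp_mk]
        rw [map_add, add_mul, map_add]
      map_smul' := fun c w => (sourceTarget T deg σ).end_ext fun z => by
        rw [RingHom.id_apply, LinearMap.smul_apply]
        simp only [SourceTarget.mulOp_mk]
        rw [map_smul, smul_mul_assoc, map_smul] }
    ((sourceTarget T deg σ).end_ext fun z => by
      simp only [LinearMap.coe_mk, AddHom.coe_mk, SourceTarget.mulOp_mk, Module.End.one_apply]
      rw [map_one, one_mul])
    (fun v w => (sourceTarget T deg σ).end_ext fun z => by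
      simp only [LinearMap.coe_mk, AddHom.coe_mk, SourceTarget.mulOp_mk, Module.End.mul_apply]
      rw [map_mul (comulBar T deg σ), mul_assoc])

theorem comulOp_mk (hT : ∀ α f, T α (T α⁻¹ f) = f) (w : FreeAlgebra k (Gen k L X))
    (z : ASigma T deg σ ⊗[k] ASigma T deg σ) :
    comulOp T deg σ hT w (BalTensor.mk _ _ z) = BalTensor.mk _ _ (comulBar T deg σ w * z) :=
  rfl

theorem comulOp_rel (hT : ∀ α f, T α (T α⁻¹ f) = f) (x y : FreeAlgebra k (Gen k L X))
    (h : SigmaRel T deg σ x y) : comulOp T deg σ hT x = comulOp T deg σ hT y :=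
  (sourceTarget T deg σ).mulOp_congr (comulBar_mul_relL T deg σ hT _)
    (comulBar_mul_relL T deg σ hT _) (comulBar_rel T deg σ h)

/-- The comultiplication `Δ_L : A_σ → A_σ ⊗_L A_σ`, sending the class of a word `w` to the class
of `comulBar w` (see `comul_proj`). -/
def comul (hT : ∀ α f, T α (T α⁻¹ f) = f) : ASigma T deg σ →ₗ[k] (sourceTarget T deg σ).TensorL :=
  (LinearMap.applyₗ (BalTensor.tmul (sourceTarget T deg σ).ract (sourceTarget T deg σ).lact 1 1)).comp
    (desc T deg σ (comulOp T deg σ hT) (comulOp_rel T deg σ hT)).toLinearMap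

theorem comul_proj (hT : ∀ α f, T α (T α⁻¹ f) = f) (w : FreeAlgebra k (Gen k L X)) :
    comul T deg σ hT (proj T deg σ w) = BalTensor.mk _ _ (comulBar T deg σ w) := by
  simp only [comul, LinearMap.comp_apply, AlgHom.toLinearMap_apply, desc_proj,
    LinearMap.applyₗ_apply_apply, BalTensor.tmul, comulOp_mk]
  rw [← Algebra.TensorProduct.one_def, mul_one]

end Comul

/-! #### The conditions on `σ` -/

variable [Group G]

/-- `ρ_l(σ^{bd}_{ac}) ∘ T_{deg d} ∘ T_{deg b} = ρ_r(σ^{bd}_{ac}) ∘ T_{deg c} ∘ T_{deg a}`, where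
`ρ_l(f)` and `ρ_r(f)` are the left and the right multiplication by `f`. -/
def LeftCondition : Prop :=
  ∀ a b c d : X, ∀ f : L,
    σ b d a c * T (deg d) (T (deg b) f) = T (deg c) (T (deg a) f) * σ b d a c

/-- The right bialgebroid condition: `T_{deg(a)⁻¹} ∘ T_{deg(c)⁻¹} ∘ ρ_l(σ^{bd}_{ac})
= T_{deg(b)⁻¹} ∘ T_{deg(d)⁻¹} ∘ ρ_r(σ^{bd}_{ac})`. -/
def RightCondition : Prop :=
  ∀ a b c d : X, ∀ f : L,
    T (deg a)⁻¹ (T (deg c)⁻¹ (σ b d a c * f)) = T (deg b)⁻¹ (T (deg d)⁻¹ (f * σ b d a c))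

theorem RightCondition.left {T : G → L ≃ₐ[k] L} {deg : X → G} {σ : X → X → X → X → L}
    (hσ : RightCondition T deg σ) (hT : ∀ α f, T α (T α⁻¹ f) = f) :
    LeftCondition T deg σ := by
  intro a b c d f
  have hT' : ∀ α f, T α⁻¹ (T α f) = f := fun α f => by simpa using hT α⁻¹ f
  have h1 := hσ a b c d 1
  have h2 := hσ a b c d (T (deg d) (T (deg b) f))
  rw [mul_one, one_mul] at h1
  rw [map_mul (T (deg d)⁻¹), map_mul (T (deg b)⁻¹), hT', hT', ← h1] at h2
  have h3 := congrArg (fun g => T (deg c) (T (deg a) g)) h2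
  simpa [hT, -map_mul, map_mul (T (deg a)) f, map_mul (T (deg c)) (T (deg a) f)] using h3

/-- `σ` is rigid. -/
def Rigid : Prop :=
  ∃ x y : X → X → ASigma T deg σ, ∀ a b,
    (∑ c, inv T deg σ c b * x a c = if a = b then 1 else 0) ∧
    (∑ c, x c b * inv T deg σ a c = if a = b then 1 else 0) ∧
    (∑ c, gen T deg σ c b * y a c = if a = b then 1 else 0) ∧
    (∑ c, y c b * gen T deg σ a c = if a = b then 1 else 0)

/-! #### The counit -/

/-- The representation of the free algebra on `L` with `l ⊗ l' ↦ (f ↦ l f l')`,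
`L_{ab} ↦ δ_{ab} T_{deg a}`, `(L⁻¹)_{ab} ↦ δ_{ab} T_{deg(a)⁻¹}`. -/
def counitBar : FreeAlgebra k (Gen k L X) →ₐ[k] Module.End k L :=
  FreeAlgebra.lift k fun
    | .base ξ => TensorProduct.lift
        (((LinearMap.mul k (Module.End k L)).compl₁₂ (LinearMap.mul k L)
          ((LinearMap.mul k L).flip.comp (opLinearEquiv k).symm.toLinearMap))) ξ
    | .gen a b => if a = b then (T (deg a)).toLinearMap else 0
    | .inv a b => if a = b then (T (deg a)⁻¹).toLinearMap else 0

@[simp] theorem counitBar_base (l : L) (l' : Lᵐᵒᵖ) (f : L) :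
    counitBar T deg (FreeGen.base X (l ⊗ₜ l')) f = l * (f * unop l') := by
  simp [counitBar]

@[simp] theorem counitBar_gen (a b : X) :
    counitBar T deg (FreeGen.gen k L a b) = if a = b then (T (deg a)).toLinearMap else 0 := by
  simp [counitBar]

@[simp] theorem counitBar_inv (a b : X) :
    counitBar T deg (FreeGen.inv k L a b)
      = if a = b then (T (deg a)⁻¹).toLinearMap else 0 := by
  simp [counitBar]

theorem counitBar_rel (hT : ∀ α f, T α (T α⁻¹ f) = f) (hσ : LeftCondition T deg σ)
    {x y : FreeAlgebra k (Gen k L X)} (h : SigmaRel T deg σ x y) :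
    counitBar T deg x = counitBar T deg y := by
  have hT' : ∀ α f, T α⁻¹ (T α f) = f := fun α f => by simpa using hT α⁻¹ f
  cases h with
  | base_add ξ η => simp [counitBar]
  | base_smul c ξ => simp [counitBar]
  | base_mul ξ η =>
    induction ξ using TensorProduct.induction_on with
    | zero => simp [counitBar]
    | add x y hx hy =>
      simp only [counitBar, map_mul, FreeAlgebra.lift_ι_apply, map_add, add_mul] at hx hy ⊢
      rw [hx, hy]
    | tmul l l' =>
      induction η using TensorProduct.induction_on with
      | zero => simp [counitBar]
      | add x y hx hy =>
        simp only [counitBar, map_mul, FreeAlgebra.lift_ι_apply, map_add, mul_add] at hx hy ⊢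
        rw [hx, hy]
      | tmul m m' =>
        ext f
        simp [Algebra.TensorProduct.tmul_mul_tmul, mul_assoc]
  | gen_inv a b =>
    ext f
    by_cases h : a = b
    · subst h; simp [hT]
    · simp [h]
  | inv_gen a b =>
    ext f
    by_cases h : a = b
    · subst h; simp [hT']
    · simp [h]
  | left_gen f a b =>
    ext g
    by_cases h : a = b
    · subst h; simp
    · simp [h]
  | right_gen f a b =>
    ext g
    by_cases h : a = b
    · subst h; simp
    · simp [h]
  | left_inv f a b =>
    ext g
    by_cases h : a = b
    · subst h; simp [hT']
    · simp [h]
  | right_inv f a b =>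
    ext g
    by_cases h : a = b
    · subst h; simp [hT']
    · simp [h]
  | exchange a b c d =>
    ext f
    simpa using hσ a b c d f
  | base_one => ext f; simp

/-- The homomorphism `ε : A_σ → End_k(L)` induced by `counitBar`. -/
def counitRep (hT : ∀ α f, T α (T α⁻¹ f) = f) (hσ : LeftCondition T deg σ) :
    ASigma T deg σ →ₐ[k] Module.End k L :=
  desc T deg σ (counitBar T deg) fun _ _ h => counitBar_rel T deg σ hT hσ h

/-- The counit `π_L(a) = ε(a)(1)`. -/
def counit (hT : ∀ α f, T α (T α⁻¹ f) = f) (hσ : LeftCondition T deg σ) :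
    ASigma T deg σ →ₗ[k] L :=
  (LinearMap.applyₗ (1 : L)).comp (counitRep T deg σ hT hσ).toLinearMap

/-- The conditions determining the anti-automorphism `S` of `A_σ`: it exchanges `s_L` and `t_L`
and takes `L_{ab}` to `(L⁻¹)_{ab}`. -/
structure IsAntipode (S : ASigma T deg σ ≃ₐ[k] (ASigma T deg σ)ᵐᵒᵖ) : Prop where
  map_s : ∀ f : L, antiMap S ((sourceTarget T deg σ).s f) = (sourceTarget T deg σ).t (op f)
  map_t : ∀ f : L, antiMap S ((sourceTarget T deg σ).t (op f)) = (sourceTarget T deg σ).s f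
  map_gen : ∀ a b, antiMap S (gen T deg σ a b) = inv T deg σ a b

end ASigma

end Sigma

end

noncomputable section

/-! ### Words in the letters `s(l)`, `t(l)`, `L_{ab}`, `(L⁻¹)_{ab}` -/

/-! On the free algebra on the letters, comultiplication is an algebra homomorphism into the tensor
square over k, and it is strictly coassociative. Every element of A_σ is the value of a word w, and
Δ_L of that value is the class of the evaluated comultiplication `evalComul w`. This element of A_σ
⊗ₖ A_σ depends on w; only its class modulo the balancing relations is determined by the value.

The crux is that Δ_{L'} has the same representatives: on the value of w it is the class of
`evalComul w` over L' (`IsAntipode.Δ'_eval`). Conjugation by S makes Δ_{L'} compatible with right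
multiplication by S of a letter. Now S takes s(l), t(l), L_{ab} to t(l), s(l), (L⁻¹)_{ab}, and the
flipped comultiplications match. The letters L_{ab} are not known to be such images; but L and L⁻¹
are inverse matrices, in A_σ and also after comultiplication, so compatibility passes from one to
the other (`RightMultiplicative.of_inverse`). The same argument with S⁻¹ treats the other conjugate
of Δ_L (`IsAntipode.twistEquiv_symm_eval`), so the two conjugates agree. Coassociativity of Δ_L and
both mixed laws are then three instances of `coassoc_of_eval`.

For the existence of S, rigidity supplies images x_{ab} for (L⁻¹)_{ab}. The exchange relation for L
is carried over to its inverse by `inverse_exchange`; the twists by the automorphisms T cancel by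
the right bialgebroid condition at f = 1. The matrix y gives an anti-endomorphism in the other
direction, and uniqueness of inverse matrices shows that the two are mutually inverse.

The counit laws and the antipode law are proved by induction on words. For the latter the statement
is strengthened to S(a₁) t(l) a₂ = t(ε(S(a))(l)), which is stable under products
(`IsAntipode.antipodeMul_evalComul_mul`). -/

/-- The letters `s(l)`, `t(l)`, `L_{ab}`, `(L⁻¹)_{ab}`. -/
inductive Letter (L X : Type*) where
  | src (l : L) : Letter L X
  | tgt (l : L) : Letter L X
  | gen (a b : X) : Letter L X
  | inv (a b : X) : Letter L X

/-- Noncommutative polynomials in the letters. -/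
abbrev LetterAlg (k L X : Type*) [CommRing k] : Type _ := FreeAlgebra k (Letter L X)

namespace LetterAlg

variable {k L X : Type*} [CommRing k] [Fintype X]

/-- The comultiplication of the letters: `s(l) ↦ s(l) ⊗ 1`, `t(l) ↦ 1 ⊗ t(l)`,
`L_{ab} ↦ ∑ L_{ac} ⊗ L_{cb}`, `(L⁻¹)_{ab} ↦ ∑ (L⁻¹)_{cb} ⊗ (L⁻¹)_{ac}`. -/
def comul : LetterAlg k L X →ₐ[k] LetterAlg k L X ⊗[k] LetterAlg k L X :=
  FreeAlgebra.lift k fun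
    | .src l => FreeAlgebra.ι k (.src l) ⊗ₜ 1
    | .tgt l => 1 ⊗ₜ FreeAlgebra.ι k (.tgt l)
    | .gen a b => ∑ c, FreeAlgebra.ι k (.gen a c) ⊗ₜ FreeAlgebra.ι k (.gen c b)
    | .inv a b => ∑ c, FreeAlgebra.ι k (.inv c b) ⊗ₜ FreeAlgebra.ι k (.inv a c)

@[simp] theorem comul_src (l : L) :
    comul (k := k) (X := X) (FreeAlgebra.ι k (.src l)) = FreeAlgebra.ι k (.src l) ⊗ₜ 1 := by
  simp [comul]

@[simp] theorem comul_tgt (l : L) :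
    comul (k := k) (X := X) (FreeAlgebra.ι k (.tgt l)) = 1 ⊗ₜ FreeAlgebra.ι k (.tgt l) := by
  simp [comul]

@[simp] theorem comul_gen (a b : X) :
    comul (k := k) (L := L) (FreeAlgebra.ι k (.gen a b))
      = ∑ c, FreeAlgebra.ι k (.gen a c) ⊗ₜ FreeAlgebra.ι k (.gen c b) := by
  simp [comul]

@[simp] theorem comul_inv (a b : X) :
    comul (k := k) (L := L) (FreeAlgebra.ι k (.inv a b))
      = ∑ c, FreeAlgebra.ι k (.inv c b) ⊗ₜ FreeAlgebra.ι k (.inv a c) := by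
  simp [comul]

/-- Both sides are algebra homomorphisms in w, so letters suffice. The letters satisfy no relations,
so the law holds over k, before any balancing; all coassociativity laws for A_σ are images of it. -/
theorem comul_coassoc (w : LetterAlg k L X) :
    Algebra.TensorProduct.assoc k k k _ _ _
        (Algebra.TensorProduct.map comul (AlgHom.id k _) (comul w))
      = Algebra.TensorProduct.map (AlgHom.id k _) comul (comul w) := by
  have : ((Algebra.TensorProduct.assoc k k k (LetterAlg k L X) (LetterAlg k L X)
        (LetterAlg k L X)).toAlgHom.comp
        (Algebra.TensorProduct.map comul (AlgHom.id k _))).comp comul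
      = (Algebra.TensorProduct.map (AlgHom.id k (LetterAlg k L X)) comul).comp comul := by
    refine FreeAlgebra.hom_ext (funext fun v => ?_)
    cases v with
    | src l => simp [Algebra.TensorProduct.one_def]
    | tgt l => simp [Algebra.TensorProduct.one_def]
    | gen a b =>
      simp [TensorProduct.sum_tmul, TensorProduct.tmul_sum]
      exact Finset.sum_comm
    | inv a b =>
      simp [TensorProduct.sum_tmul, TensorProduct.tmul_sum]
      exact Finset.sum_comm
  exact DFunLike.congr_fun this w

end LetterAlg

namespace ASigma

variable {k L G X : Type*} [CommRing k] [Ring L] [Algebra k L] [Fintype X] [DecidableEq X]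
  (T : G → L ≃ₐ[k] L) (deg : X → G) (σ : X → X → X → X → L)

/-- A letter as an element of the free algebra on the generators of `A_σ`. -/
def word : LetterAlg k L X →ₐ[k] FreeAlgebra k (Gen k L X) :=
  FreeAlgebra.lift k fun
    | .src l => FreeGen.base X (l ⊗ₜ 1)
    | .tgt l => FreeGen.base X (1 ⊗ₜ op l)
    | .gen a b => FreeGen.gen k L a b
    | .inv a b => FreeGen.inv k L a b

/-- The value of a word in `A_σ`. -/
def eval : LetterAlg k L X →ₐ[k] ASigma T deg σ := (proj T deg σ).comp word

@[simp] theorem eval_src (l : L) :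
    eval T deg σ (FreeAlgebra.ι k (.src l)) = (sourceTarget T deg σ).s l := by
  simp [eval, word]; rfl

@[simp] theorem eval_tgt (l : L) :
    eval T deg σ (FreeAlgebra.ι k (.tgt l)) = (sourceTarget T deg σ).t (op l) := by
  simp [eval, word]; rfl

@[simp] theorem eval_gen (a b : X) :
    eval T deg σ (FreeAlgebra.ι k (.gen a b)) = gen T deg σ a b := by
  simp [eval, word]; rfl

@[simp] theorem eval_inv (a b : X) :
    eval T deg σ (FreeAlgebra.ι k (.inv a b)) = inv T deg σ a b := by
  simp [eval, word]; rfl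

theorem proj_base_tmul (l : L) (l' : Lᵐᵒᵖ) :
    proj T deg σ (FreeGen.base X (l ⊗ₜ l'))
      = (sourceTarget T deg σ).s l * (sourceTarget T deg σ).t l' := by
  change base T deg σ (l ⊗ₜ l') = base T deg σ (l ⊗ₜ 1) * base T deg σ (1 ⊗ₜ l')
  rw [← map_mul]
  simp

/-- Only the generators from L ⊗ₖ Lᵒᵖ need care: they are sums of products s(l) t(l'). -/
theorem eval_surjective : Function.Surjective (eval T deg σ) := by
  intro a
  obtain ⟨w, rfl⟩ := RingQuot.mkAlgHom_surjective k (SigmaRel T deg σ) a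
  change proj T deg σ w ∈ (eval T deg σ).range
  induction w using FreeAlgebra.induction with
  | grade0 r => rw [AlgHom.commutes]; exact Subalgebra.algebraMap_mem _ _
  | mul a b ha hb => rw [map_mul]; exact mul_mem ha hb
  | add a b ha hb => rw [map_add]; exact add_mem ha hb
  | grade1 v =>
    cases v with
    | gen a b => exact ⟨_, eval_gen T deg σ a b⟩
    | inv a b => exact ⟨_, eval_inv T deg σ a b⟩
    | base ξ =>
      change base T deg σ ξ ∈ _
      induction ξ using TensorProduct.induction_on with
      | zero => rw [map_zero]; exact zero_mem _
      | add x y hx hy => rw [map_add]; exact add_mem hx hy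
      | tmul l l' =>
        exact (proj_base_tmul T deg σ l l').symm ▸
          mul_mem ⟨_, eval_src T deg σ l⟩ ⟨_, eval_tgt T deg σ (unop l')⟩

/-- The comultiplication of a word, evaluated in `A_σ ⊗ₖ A_σ`. -/
def evalComul : LetterAlg k L X →ₐ[k] ASigma T deg σ ⊗[k] ASigma T deg σ :=
  (Algebra.TensorProduct.map (eval T deg σ) (eval T deg σ)).comp LetterAlg.comul

@[simp] theorem evalComul_src (l : L) :
    evalComul T deg σ (FreeAlgebra.ι k (.src l)) = (sourceTarget T deg σ).s l ⊗ₜ 1 := by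
  simp [evalComul]

@[simp] theorem evalComul_tgt (l : L) :
    evalComul T deg σ (FreeAlgebra.ι k (.tgt l)) = 1 ⊗ₜ (sourceTarget T deg σ).t (op l) := by
  simp [evalComul]

@[simp] theorem evalComul_gen (a b : X) :
    evalComul T deg σ (FreeAlgebra.ι k (.gen a b))
      = ∑ c, gen T deg σ a c ⊗ₜ gen T deg σ c b := by
  simp [evalComul]

@[simp] theorem evalComul_inv (a b : X) :
    evalComul T deg σ (FreeAlgebra.ι k (.inv a b))
      = ∑ c, inv T deg σ c b ⊗ₜ inv T deg σ a c := by
  simp [evalComul]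

theorem comulBar_word (w : LetterAlg k L X) :
    comulBar T deg σ (word w) = evalComul T deg σ w := by
  have : (comulBar T deg σ).comp word = evalComul T deg σ := by
    refine FreeAlgebra.hom_ext (funext fun v => ?_)
    cases v <;> simp [word]
  exact DFunLike.congr_fun this w

/-- A linear map on `A_σ ⊗ₖ A_σ` taking products with the comultiplication of a letter to products
with that letter does so for all words. -/
theorem apply_evalComul_mul (Φ : ASigma T deg σ ⊗[k] ASigma T deg σ →ₗ[k] ASigma T deg σ)
    (h : ∀ v m n, Φ (evalComul T deg σ (FreeAlgebra.ι k v) * (m ⊗ₜ n))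
      = eval T deg σ (FreeAlgebra.ι k v) * Φ (m ⊗ₜ n))
    (w : LetterAlg k L X) (z : ASigma T deg σ ⊗[k] ASigma T deg σ) :
    Φ (evalComul T deg σ w * z) = eval T deg σ w * Φ z := by
  induction w using FreeAlgebra.induction generalizing z with
  | grade0 r =>
    rw [AlgHom.commutes, AlgHom.commutes, ← Algebra.smul_def, ← Algebra.smul_def, map_smul]
  | mul a b ha hb =>
    rw [map_mul (evalComul T deg σ), map_mul (eval T deg σ), mul_assoc, ha, hb, mul_assoc]
  | add a b ha hb => rw [map_add, map_add, add_mul, map_add, ha, hb, add_mul]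
  | grade1 v =>
    induction z using TensorProduct.induction_on with
    | zero => simp
    | add x y hx hy => rw [mul_add, map_add, hx, hy, map_add, mul_add]
    | tmul m n => exact h v m n

/-! ### Coassociativity for two comultiplications with common representatives -/

section Mixed

variable {R Q : Type*}

/-- Both composites, applied to the value of w, are images of the twofold comultiplication of w in
the free algebra, where the two bracketings agree. The two balancings are kept independent, so the
lemma covers Δ_L alone and both mixed laws. -/
theorem coassoc_of_eval {ρ₁ lam₁ : R → Module.End k (ASigma T deg σ)}
    {ρ₂ lam₂ : Q → Module.End k (ASigma T deg σ)}
    (h : ∀ r q n, lam₁ r (ρ₂ q n) = ρ₂ q (lam₁ r n))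
    (D₁ : ASigma T deg σ →ₗ[k] BalTensor ρ₁ lam₁) (D₂ : ASigma T deg σ →ₗ[k] BalTensor ρ₂ lam₂)
    (h₁ : ∀ w, D₁ (eval T deg σ w) = BalTensor.mk ρ₁ lam₁ (evalComul T deg σ w))
    (h₂ : ∀ w, D₂ (eval T deg σ w) = BalTensor.mk ρ₂ lam₂ (evalComul T deg σ w))
    (l₁ : ∀ q a, D₁ (ρ₂ q a) = BalTensor.actSnd (ρ₂ q) (fun r n => (h r q n).symm) (D₁ a))
    (l₂ : ∀ r a, D₂ (lam₁ r a) = BalTensor.actFst (lam₁ r) (fun q n => h r q n) (D₂ a))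
    (a : ASigma T deg σ) :
    BalTensor.assoc ρ₁ lam₁ ρ₂ lam₂ h (BalTensor.mapFst _ D₁ l₁ (D₂ a))
      = BalTensor.mapSnd _ D₂ l₂ (D₁ a) := by
  obtain ⟨w, rfl⟩ := eval_surjective T deg σ a
  -- The projection of the threefold tensor product over k onto the doubly balanced one; both
  -- composites will be written as `mk₃` after `ev₃`.
  let mk₃ : ASigma T deg σ ⊗[k] (ASigma T deg σ ⊗[k] ASigma T deg σ) →ₗ[k]
      BalTensor (N := BalTensor ρ₂ lam₂) ρ₁
        (fun r => BalTensor.actFst (lam₁ r) (fun q n => h r q n)) :=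
    (BalTensor.mk _ _).comp (LinearMap.lTensor _ (BalTensor.mk ρ₂ lam₂))
  let ev₃ := Algebra.TensorProduct.map (eval T deg σ)
    (Algebra.TensorProduct.map (eval T deg σ) (eval T deg σ))
  have hl : ∀ y : LetterAlg k L X ⊗[k] LetterAlg k L X,
      BalTensor.assoc ρ₁ lam₁ ρ₂ lam₂ h (BalTensor.mapFst _ D₁ l₁
        (BalTensor.mk ρ₂ lam₂ (Algebra.TensorProduct.map (eval T deg σ) (eval T deg σ) y)))
      = mk₃ (ev₃ (Algebra.TensorProduct.assoc k k k _ _ _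
        (Algebra.TensorProduct.map LetterAlg.comul (AlgHom.id k _) y))) := by
    intro y
    induction y using TensorProduct.induction_on with
    | zero => simp
    | add x y hx hy => simp only [map_add, hx, hy]
    | tmul u v =>
      simp only [Algebra.TensorProduct.map_tmul, BalTensor.mapFst, BalTensor.map_tmul, h₁,
        evalComul, AlgHom.comp_apply, AlgHom.coe_id, id_eq, LinearMap.id_apply]
      induction LetterAlg.comul u using TensorProduct.induction_on with
      | zero => simp only [map_zero, TensorProduct.zero_tmul, BalTensor.tmul]
      | add x y hx hy =>
        simp only [map_add, TensorProduct.add_tmul, BalTensor.tmul] at hx hy ⊢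
        rw [hx, hy]
      | tmul p q =>
        simp only [Algebra.TensorProduct.map_tmul]
        exact BalTensor.assoc_tmul ρ₁ lam₁ ρ₂ lam₂ h _ _ _
  have hr : ∀ y : LetterAlg k L X ⊗[k] LetterAlg k L X,
      BalTensor.mapSnd _ D₂ l₂
        (BalTensor.mk ρ₁ lam₁ (Algebra.TensorProduct.map (eval T deg σ) (eval T deg σ) y))
      = mk₃ (ev₃ (Algebra.TensorProduct.map (AlgHom.id k _) LetterAlg.comul y)) := by
    intro y
    induction y using TensorProduct.induction_on with
    | zero => simp
    | add x y hx hy => simp only [map_add, hx, hy]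
    | tmul u v =>
      simp only [Algebra.TensorProduct.map_tmul, BalTensor.mapSnd, BalTensor.map_tmul, h₂,
        evalComul, AlgHom.comp_apply, AlgHom.coe_id, id_eq, LinearMap.id_apply]
      rfl
  rw [h₁, h₂, evalComul, AlgHom.comp_apply, hl, hr, LetterAlg.comul_coassoc]

end Mixed

/-! ### The left bialgebroid -/

theorem mk_eq_mk {z z' : ASigma T deg σ ⊗[k] ASigma T deg σ} :
    BalTensor.mk (sourceTarget T deg σ).ract (sourceTarget T deg σ).lact z
      = BalTensor.mk (sourceTarget T deg σ).ract (sourceTarget T deg σ).lact z'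
      ↔ z - z' ∈ (sourceTarget T deg σ).relL :=
  Submodule.Quotient.eq _

variable [Group G]

theorem comul_eval (hT : ∀ α f, T α (T α⁻¹ f) = f) (w : LetterAlg k L X) :
    comul T deg σ hT (eval T deg σ w) = BalTensor.mk _ _ (evalComul T deg σ w) := by
  rw [← comulBar_word]
  exact comul_proj T deg σ hT _

theorem evalComul_mul_relL (hT : ∀ α f, T α (T α⁻¹ f) = f) (w : LetterAlg k L X)
    (z : ASigma T deg σ ⊗[k] ASigma T deg σ) (hz : z ∈ (sourceTarget T deg σ).relL) :
    evalComul T deg σ w * z ∈ (sourceTarget T deg σ).relL := by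
  rw [← comulBar_word]
  exact comulBar_mul_relL T deg σ hT _ z hz

/-- Any representative z of Δ_L(a) may be used, because left multiplication by an evaluated
comultiplication preserves `relL`. Arbitrary elements of A_σ ⊗ₖ A_σ need not do so. -/
theorem comul_eval_mul (hT : ∀ α f, T α (T α⁻¹ f) = f) (w : LetterAlg k L X)
    (a : ASigma T deg σ) (z : ASigma T deg σ ⊗[k] ASigma T deg σ)
    (hz : comul T deg σ hT a = BalTensor.mk _ _ z) :
    comul T deg σ hT (eval T deg σ w * a) = BalTensor.mk _ _ (evalComul T deg σ w * z) := by
  obtain ⟨v, rfl⟩ := eval_surjective T deg σ a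
  rw [comul_eval, mk_eq_mk] at hz
  rw [← map_mul, comul_eval, mk_eq_mk, map_mul, ← mul_sub]
  exact evalComul_mul_relL T deg σ hT w _ hz

/-- Here independence of the representative is automatic, since `relL` is a right ideal. -/
theorem comul_mul_eval (hT : ∀ α f, T α (T α⁻¹ f) = f) (w : LetterAlg k L X)
    (a : ASigma T deg σ) (z : ASigma T deg σ ⊗[k] ASigma T deg σ)
    (hz : comul T deg σ hT a = BalTensor.mk _ _ z) :
    comul T deg σ hT (a * eval T deg σ w) = BalTensor.mk _ _ (z * evalComul T deg σ w) := by
  obtain ⟨v, rfl⟩ := eval_surjective T deg σ a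
  rw [comul_eval, mk_eq_mk] at hz
  rw [← map_mul, comul_eval, mk_eq_mk, map_mul, ← sub_mul]
  exact (sourceTarget T deg σ).relL_mul _ _ hz

/-- `f ⊗ id` acts as left multiplication when `f` does. -/
theorem _root_.BalTensor.actFst_mk {R A : Type*} [Ring A] [Algebra k A]
    {ρ lam : R → Module.End k A} (f : Module.End k A) (hf : ∀ r m, f (ρ r m) = ρ r (f m))
    (z : A ⊗[k] A) :
    BalTensor.actFst (lam := lam) f hf (BalTensor.mk ρ lam z)
      = BalTensor.mk ρ lam (TensorProduct.map f LinearMap.id z) := by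
  induction z using TensorProduct.induction_on with
  | zero => simp
  | add x y hx hy => simp only [map_add, hx, hy]
  | tmul u v => simp [BalTensor.actFst, BalTensor.mapFst]

theorem _root_.BalTensor.actSnd_mk {R A : Type*} [Ring A] [Algebra k A]
    {ρ lam : R → Module.End k A} (g : Module.End k A) (hg : ∀ r n, g (lam r n) = lam r (g n))
    (z : A ⊗[k] A) :
    BalTensor.actSnd (ρ := ρ) g hg (BalTensor.mk ρ lam z)
      = BalTensor.mk ρ lam (TensorProduct.map LinearMap.id g z) := by
  induction z using TensorProduct.induction_on with
  | zero => simp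
  | add x y hx hy => simp only [map_add, hx, hy]
  | tmul u v => simp [BalTensor.actSnd, BalTensor.mapSnd]

/-! ### One-sided multiplications on the tensor square -/

section TensorMul

variable {A : Type*} [Ring A] [Algebra k A]

theorem map_mulLeft_id (a : A) (z : A ⊗[k] A) :
    TensorProduct.map (LinearMap.mulLeft k a) LinearMap.id z = (a ⊗ₜ[k] 1) * z := by
  induction z using TensorProduct.induction_on with
  | zero => simp
  | add x y hx hy => simp only [map_add, hx, hy, mul_add]
  | tmul u v => simp

theorem map_id_mulLeft (a : A) (z : A ⊗[k] A) :
    TensorProduct.map LinearMap.id (LinearMap.mulLeft k a) z = (1 ⊗ₜ[k] a) * z := by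
  induction z using TensorProduct.induction_on with
  | zero => simp
  | add x y hx hy => simp only [map_add, hx, hy, mul_add]
  | tmul u v => simp

theorem map_mulRight_id (a : A) (z : A ⊗[k] A) :
    TensorProduct.map (LinearMap.mulRight k a) LinearMap.id z = z * (a ⊗ₜ[k] 1) := by
  induction z using TensorProduct.induction_on with
  | zero => simp
  | add x y hx hy => simp only [map_add, hx, hy, add_mul]
  | tmul u v => simp

theorem map_id_mulRight (a : A) (z : A ⊗[k] A) :
    TensorProduct.map LinearMap.id (LinearMap.mulRight k a) z = z * (1 ⊗ₜ[k] a) := by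
  induction z using TensorProduct.induction_on with
  | zero => simp
  | add x y hx hy => simp only [map_add, hx, hy, add_mul]
  | tmul u v => simp

end TensorMul

/-! ### The counit laws and the bialgebroid axioms -/

section Counit

variable (hT : ∀ α f, T α (T α⁻¹ f) = f) (hσ : LeftCondition T deg σ)

theorem counitRep_proj (w : FreeAlgebra k (Gen k L X)) :
    counitRep T deg σ hT hσ (proj T deg σ w) = counitBar T deg w :=
  desc_proj T deg σ _ _ w

@[simp] theorem counitRep_s (l f : L) :
    counitRep T deg σ hT hσ ((sourceTarget T deg σ).s l) f = l * f := by
  change counitRep T deg σ hT hσ (proj T deg σ (FreeGen.base X (l ⊗ₜ 1))) f = _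
  rw [counitRep_proj, counitBar_base]; simp

@[simp] theorem counitRep_t (l : Lᵐᵒᵖ) (f : L) :
    counitRep T deg σ hT hσ ((sourceTarget T deg σ).t l) f = f * unop l := by
  change counitRep T deg σ hT hσ (proj T deg σ (FreeGen.base X (1 ⊗ₜ l))) f = _
  rw [counitRep_proj, counitBar_base]; simp

@[simp] theorem counitRep_gen (a b : X) (f : L) :
    counitRep T deg σ hT hσ (gen T deg σ a b) f = if a = b then T (deg a) f else 0 := by
  rw [gen, counitRep_proj, counitBar_gen]; split_ifs <;> simp

@[simp] theorem counitRep_inv (a b : X) (f : L) :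
    counitRep T deg σ hT hσ (inv T deg σ a b) f = if a = b then T (deg a)⁻¹ f else 0 := by
  rw [inv, counitRep_proj, counitBar_inv]; split_ifs <;> simp

theorem counit_apply (a : ASigma T deg σ) :
    counit T deg σ hT hσ a = counitRep T deg σ hT hσ a 1 := rfl

theorem counit_mul (a b : ASigma T deg σ) :
    counit T deg σ hT hσ (a * b)
      = counitRep T deg σ hT hσ a (counit T deg σ hT hσ b) := by
  simp [counit_apply]

/-- The map `m ⊗ n ↦ s(π(m)) n`. -/
def counitMulLeft : ASigma T deg σ ⊗[k] ASigma T deg σ →ₗ[k] ASigma T deg σ :=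
  TensorProduct.lift ((LinearMap.mul k (ASigma T deg σ)).comp
    ((sourceTarget T deg σ).s.toLinearMap.comp (counit T deg σ hT hσ)))

@[simp] theorem counitMulLeft_tmul (m n : ASigma T deg σ) :
    counitMulLeft T deg σ hT hσ (m ⊗ₜ n)
      = (sourceTarget T deg σ).s (counit T deg σ hT hσ m) * n := rfl

/-- For the letter L_{ab} the counit kills every term of the sum except c = a. What is left is
s(T_{deg a}(π(m))) L_{ab} n, and a defining relation moves the scalar to the right of L_{ab}. So the
map intertwines letters with their comultiplications; the claim is the value at 1 ⊗ 1. -/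
theorem counitMulLeft_evalComul (w : LetterAlg k L X) :
    counitMulLeft T deg σ hT hσ (evalComul T deg σ w) = eval T deg σ w := by
  have := apply_evalComul_mul T deg σ (counitMulLeft T deg σ hT hσ) ?_ w (1 ⊗ₜ 1)
  · rw [← Algebra.TensorProduct.one_def, mul_one] at this
    rw [this, Algebra.TensorProduct.one_def, counitMulLeft_tmul, counit_apply,
      map_one (counitRep T deg σ hT hσ)]
    simp
  · intro v m n
    cases v with
    | src l => simp [counit_mul, mul_assoc]
    | tgt l =>
      simp only [evalComul_tgt, Algebra.TensorProduct.tmul_mul_tmul, one_mul, eval_tgt,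
        counitMulLeft_tmul, ← mul_assoc, (sourceTarget T deg σ).comm]
    | gen a b =>
      simp [Finset.sum_mul, counit_mul, ← mul_assoc, ite_mul, apply_ite, s_gen]
    | inv a b =>
      simp only [evalComul_inv, Finset.sum_mul, Algebra.TensorProduct.tmul_mul_tmul, map_sum,
        counitMulLeft_tmul, counit_mul, counitRep_inv, eval_inv, apply_ite, map_zero, ite_mul,
        zero_mul, Finset.sum_ite_eq', Finset.mem_univ, if_true, ← mul_assoc, s_inv, hT]

/-- The map `m ⊗ n ↦ t(π(n)) m`. -/
def counitMulRight : ASigma T deg σ ⊗[k] ASigma T deg σ →ₗ[k] ASigma T deg σ :=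
  TensorProduct.lift ((LinearMap.mul k (ASigma T deg σ)).flip.compl₂
    ((sourceTarget T deg σ).t.toLinearMap.comp
      ((opLinearEquiv k).toLinearMap.comp (counit T deg σ hT hσ))))

@[simp] theorem counitMulRight_tmul (m n : ASigma T deg σ) :
    counitMulRight T deg σ hT hσ (m ⊗ₜ n)
      = (sourceTarget T deg σ).t (op (counit T deg σ hT hσ n)) * m := rfl

theorem counitMulRight_evalComul (w : LetterAlg k L X) :
    counitMulRight T deg σ hT hσ (evalComul T deg σ w) = eval T deg σ w := by
  have := apply_evalComul_mul T deg σ (counitMulRight T deg σ hT hσ) ?_ w (1 ⊗ₜ 1)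
  · rw [← Algebra.TensorProduct.one_def, mul_one] at this
    rw [this, Algebra.TensorProduct.one_def, counitMulRight_tmul, counit_apply,
      map_one (counitRep T deg σ hT hσ)]
    simp
  · intro v m n
    cases v with
    | tgt l => simp [counit_mul, mul_assoc]
    | src l =>
      simp only [evalComul_src, Algebra.TensorProduct.tmul_mul_tmul, one_mul, eval_src,
        counitMulRight_tmul, ← mul_assoc, (sourceTarget T deg σ).comm]
    | gen a b =>
      simp [Finset.sum_mul, counit_mul, ← mul_assoc, ite_mul, apply_ite, t_gen]
    | inv a b =>
      simp [Finset.sum_mul, counit_mul, ← mul_assoc, ite_mul, apply_ite, t_inv, hT]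

theorem isLeftBialgebroid :
    IsLeftBialgebroid (sourceTarget T deg σ) (comul T deg σ hT) (counit T deg σ hT hσ) where
  Δ_lact l a := by
    obtain ⟨z, hz⟩ := BalTensor.mk_surjective _ _ (comul T deg σ hT a)
    have := comul_eval_mul T deg σ hT (FreeAlgebra.ι k (.src l)) a z hz.symm
    rw [eval_src, evalComul_src] at this
    rw [← hz, SourceTarget.lactL, BalTensor.actFst_mk, SourceTarget.lact, map_mulLeft_id]
    exact this
  Δ_ract l a := by
    obtain ⟨z, hz⟩ := BalTensor.mk_surjective _ _ (comul T deg σ hT a)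
    have := comul_eval_mul T deg σ hT (FreeAlgebra.ι k (.tgt l)) a z hz.symm
    rw [eval_tgt, evalComul_tgt] at this
    rw [← hz, SourceTarget.ractL, BalTensor.actSnd_mk, SourceTarget.ract, map_id_mulLeft]
    exact this
  π_lact l a := by simp [SourceTarget.lact, counit_mul]
  π_ract l a := by simp [SourceTarget.ract, counit_mul]
  coassoc := coassoc_of_eval T deg σ _ _ _ (comul_eval T deg σ hT) (comul_eval T deg σ hT) _ _
  counit_left a := by
    obtain ⟨w, rfl⟩ := eval_surjective T deg σ a
    rw [comul_eval]
    exact counitMulLeft_evalComul T deg σ hT hσ w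
  counit_right a := by
    obtain ⟨w, rfl⟩ := eval_surjective T deg σ a
    rw [comul_eval]
    exact counitMulRight_evalComul T deg σ hT hσ w
  takeuchi l a := by
    obtain ⟨w, rfl⟩ := eval_surjective T deg σ a
    rw [comul_eval]
    refine (BalTensor.actFst_mk _ _ _).trans (Eq.trans ?_ (BalTensor.actSnd_mk _ _ _).symm)
    rw [map_mulRight_id, map_id_mulRight, mk_eq_mk, ← mul_sub]
    -- The difference of the two sides is `evalComul w` times the balancing generator t(l) ⊗ 1 − 1 ⊗
    -- s(l).
    refine evalComul_mul_relL T deg σ hT w _ ?_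
    simpa using (sourceTarget T deg σ).relL_gen l 1 1
  Δ_one := by
    have := comul_eval T deg σ hT 1
    rwa [map_one (eval T deg σ), map_one (evalComul T deg σ), Algebra.TensorProduct.one_def] at this
  Δ_mul a b x y hx hy := by
    obtain ⟨w, rfl⟩ := eval_surjective T deg σ a
    rw [comul_eval, mk_eq_mk] at hx
    -- The representative y is arbitrary by `comul_eval_mul`; replacing `evalComul w` by x costs
    -- only the right ideal property.
    rw [comul_eval_mul T deg σ hT w b y hy.symm, eq_comm, mk_eq_mk, ← sub_mul]
    exact (sourceTarget T deg σ).relL_mul _ _ hx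
  π_one := by simp [counit_apply]
  π_mul_s a b := by simp [counit_apply]
  π_mul_t a b := by simp [counit_apply]

end Counit

end ASigma

/-! ### Mutually inverse matrices over a noncommutative ring -/

section InverseMatrices

variable {A L X : Type*} [Ring A] [Fintype X] [DecidableEq X] {u v : X → X → A}

/-- A row vector is recovered from its product with u by multiplying by the right inverse v. This
strips one matrix factor at a time from longer relations. -/
theorem eq_sum_mul_of_sum_mul_eq (huv : ∀ a b, ∑ c, u a c * v c b = if a = b then 1 else 0)
    {P W : X → A} (h : ∀ b, ∑ x, P x * u x b = W b) (x : X) : P x = ∑ b, W b * v b x := by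
  simp only [← h, Finset.sum_mul, mul_assoc]
  rw [Finset.sum_comm]
  simp [← Finset.mul_sum, huv]

theorem eq_sum_mul_of_mul_sum_eq (hvu : ∀ a b, ∑ c, v a c * u c b = if a = b then 1 else 0)
    {P W : X → A} (h : ∀ b, ∑ x, u b x * P x = W b) (x : X) : P x = ∑ b, v x b * W b := by
  simp only [← h, Finset.mul_sum, ← mul_assoc]
  rw [Finset.sum_comm]
  simp [← Finset.sum_mul, hvu]

theorem inverse_unique {v' : X → X → A}
    (huv : ∀ a b, ∑ c, u a c * v c b = if a = b then 1 else 0)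
    (hvu : ∀ a b, ∑ c, v' a c * u c b = if a = b then 1 else 0) (a b : X) : v' a b = v a b := by
  rw [eq_sum_mul_of_sum_mul_eq huv (hvu a) b]
  simp

/-- If `p u_{ac} = u_{ac} q_c`, then `v_{ab} p = q_a v_{ab}` for the inverse matrix `v`. -/
theorem inverse_mul_of_col (huv : ∀ a b, ∑ c, u a c * v c b = if a = b then 1 else 0)
    (hvu : ∀ a b, ∑ c, v a c * u c b = if a = b then 1 else 0) {p : A} {q : X → A}
    (h : ∀ a c, p * u a c = u a c * q c) (a b : X) : v a b * p = q a * v a b := by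
  have := eq_sum_mul_of_sum_mul_eq huv (P := fun x => v a x * p)
    (W := fun b => if a = b then q b else 0) (fun b => by
      simp only [mul_assoc, h]
      simp only [← mul_assoc, ← Finset.sum_mul, hvu, ite_mul, one_mul, zero_mul]) b
  simpa using this

/-- If `u_{ac} q = p_a u_{ac}`, then `q v_{ab} = v_{ab} p_b` for the inverse matrix `v`. -/
theorem mul_inverse_of_row (huv : ∀ a b, ∑ c, u a c * v c b = if a = b then 1 else 0)
    (hvu : ∀ a b, ∑ c, v a c * u c b = if a = b then 1 else 0) {p : X → A} {q : A}
    (h : ∀ a c, u a c * q = p a * u a c) (a b : X) : q * v a b = v a b * p b := by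
  have := eq_sum_mul_of_mul_sum_eq hvu (P := fun x => q * v x b)
    (W := fun a => if a = b then p a else 0) (fun a => by
      simp only [← mul_assoc, h]
      simp only [mul_assoc, ← Finset.mul_sum, huv, mul_ite, mul_one, mul_zero]) a
  simpa using this

/-- An exchange relation for a matrix implies one for its inverse. -/
theorem inverse_exchange (huv : ∀ a b, ∑ c, u a c * v c b = if a = b then 1 else 0)
    (hvu : ∀ a b, ∑ c, v a c * u c b = if a = b then 1 else 0)
    {θ : L → A} {φ ψ : X → L → L} (hψ : ∀ a b f, v a b * θ f = θ (ψ a f) * v a b)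
    (hφ : ∀ a b f, θ f * v a b = v a b * θ (φ a f))
    {ω : X → X → X → X → A} {τ : X → X → X → X → L}
    (hτ : ∀ b d p q, φ d (φ b (ψ p (ψ q (τ b d p q)))) = τ b d p q)
    (h : ∀ a b c d, ∑ x, ∑ y, ω x y a c * u y d * u x b
      = ∑ x, ∑ y, θ (τ b d x y) * u c y * u a x) (p q r s : X) :
    ∑ a, ∑ c, v p a * v q c * ω r s a c = ∑ b, ∑ d, v b r * v d s * θ (τ b d p q) := by
  -- Passing v_{qc} to the right of θ(τ) twists the scalar by ψ_q; then v u = 1 collapses the sum to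
  -- y = q.
  have h₁ : ∀ a b d, ∑ c, v q c * ∑ x, ∑ y, θ (τ b d x y) * u c y * u a x
      = ∑ x, θ (ψ q (τ b d x q)) * u a x := by
    intro a b d
    simp only [Finset.mul_sum]
    rw [Finset.sum_comm]
    refine Finset.sum_congr rfl fun x _ => ?_
    rw [Finset.sum_comm]
    have : ∀ y c, v q c * (θ (τ b d x y) * u c y * u a x)
        = θ (ψ q (τ b d x y)) * (v q c * u c y) * u a x := fun y c => by
      rw [← mul_assoc, ← mul_assoc, hψ, mul_assoc (θ _) (v q c)]
    simp only [this, ← Finset.sum_mul, ← Finset.mul_sum, hvu]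
    simp
  have h₂ : ∀ b d, ∑ a, v p a * ∑ x, θ (ψ q (τ b d x q)) * u a x
      = θ (ψ p (ψ q (τ b d p q))) := by
    intro b d
    simp only [Finset.mul_sum]
    rw [Finset.sum_comm]
    simp only [← mul_assoc, hψ]
    simp only [mul_assoc, ← Finset.mul_sum, hvu]
    simp
  -- With `h₁` and `h₂`, multiplication from the left by two entries of v removes both factors u
  -- from the right-hand side. The two factors u still on the left-hand side are stripped from the
  -- right in `h₄` and `h₅`.
  have h₃ : ∀ b d, ∑ x, (∑ y, (∑ a, ∑ c, v p a * v q c * ω x y a c) * u y d) * u x b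
      = θ (ψ p (ψ q (τ b d p q))) := by
    intro b d
    rw [← h₂]
    simp only [← h₁, ← h, Finset.mul_sum, Finset.sum_mul]
    rw [ASigma.sum_swap (fun x y a c => v p a * v q c * ω x y a c * u y d * u x b)]
    simp only [mul_assoc]
  have h₄ := fun b => fun d => eq_sum_mul_of_sum_mul_eq huv (h₃ · d) b
  have h₅ := eq_sum_mul_of_sum_mul_eq huv (h₄ r) s
  rw [h₅]
  simp only [Finset.sum_mul]
  rw [Finset.sum_comm]
  refine Finset.sum_congr rfl fun b _ => Finset.sum_congr rfl fun d _ => ?_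
  -- Moving the scalar back to the right past two entries of v applies φ_b and then φ_d; by `hτ`
  -- this undoes ψ_q and ψ_p.
  rw [hφ, mul_assoc, hφ, hτ, ← mul_assoc]

end InverseMatrices

namespace ASigma

variable {k L G X : Type*} [CommRing k] [Ring L] [Algebra k L] [Fintype X] [DecidableEq X]
  (T : G → L ≃ₐ[k] L) (deg : X → G) (σ : X → X → X → X → L)

/-! ### Homomorphisms out of A_σ -/

section Ext

variable {T deg σ} {C : Type*} [Ring C] [Algebra k C] {φ ψ : ASigma T deg σ →ₐ[k] C}

theorem algHom_ext (hs : ∀ l, φ ((sourceTarget T deg σ).s l) = ψ ((sourceTarget T deg σ).s l))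
    (ht : ∀ l, φ ((sourceTarget T deg σ).t (op l)) = ψ ((sourceTarget T deg σ).t (op l)))
    (hgen : ∀ a b, φ (gen T deg σ a b) = ψ (gen T deg σ a b))
    (hinv : ∀ a b, φ (inv T deg σ a b) = ψ (inv T deg σ a b)) : φ = ψ := by
  have : φ.comp (eval T deg σ) = ψ.comp (eval T deg σ) := by
    refine FreeAlgebra.hom_ext (funext fun v => ?_)
    cases v <;> simp [hs, ht, hgen, hinv]
  ext a
  obtain ⟨w, rfl⟩ := eval_surjective T deg σ a
  exact DFunLike.congr_fun this w

theorem map_gen_mul_inv (φ : ASigma T deg σ →ₐ[k] C) (a b : X) :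
    ∑ c, φ (gen T deg σ a c) * φ (inv T deg σ c b) = if a = b then 1 else 0 := by
  simp only [← map_mul, ← map_sum, gen_mul_inv]
  split_ifs <;> simp

theorem map_inv_mul_gen (φ : ASigma T deg σ →ₐ[k] C) (a b : X) :
    ∑ c, φ (inv T deg σ a c) * φ (gen T deg σ c b) = if a = b then 1 else 0 := by
  simp only [← map_mul, ← map_sum, inv_mul_gen]
  split_ifs <;> simp

/-- The images of L and L⁻¹ are again inverse matrices, so one determines the other. This controls
composites of anti-homomorphisms on generators whose image under the first map is known only as
x_{ab} or y_{ab}. -/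
theorem map_inv_eq_of_map_gen_eq (h : ∀ a b, φ (gen T deg σ a b) = ψ (gen T deg σ a b))
    (a b : X) : φ (inv T deg σ a b) = ψ (inv T deg σ a b) :=
  inverse_unique (map_gen_mul_inv ψ)
    (fun a b => by simpa only [h] using map_inv_mul_gen φ a b) a b

theorem map_gen_eq_of_map_inv_eq (h : ∀ a b, φ (inv T deg σ a b) = ψ (inv T deg σ a b))
    (a b : X) : φ (gen T deg σ a b) = ψ (gen T deg σ a b) :=
  inverse_unique (map_inv_mul_gen ψ)
    (fun a b => by simpa only [h] using map_gen_mul_inv φ a b) a b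

end Ext

/-! ### The anti-automorphism -/

section AntiHom

/-- The anti-homomorphism `L ⊗ₖ Lᵒᵖ → A_σ` with `l ⊗ 1 ↦ t(l)` and `1 ⊗ l ↦ s(l)`. -/
def baseAnti : L ⊗[k] Lᵐᵒᵖ →ₐ[k] (ASigma T deg σ)ᵐᵒᵖ :=
  Algebra.TensorProduct.lift (AlgHom.opComm.symm (sourceTarget T deg σ).t)
    (AlgHom.op (sourceTarget T deg σ).s) (fun l l' => by
      refine unop_injective ?_
      simpa using (sourceTarget T deg σ).comm (unop l') l)

/-- The anti-homomorphism from the free algebra to `A_σ` that exchanges `s` and `t` and takes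
`L_{ab}` to `g_{ab}` and `(L⁻¹)_{ab}` to `h_{ab}`. -/
def freeAnti (g h : X → X → ASigma T deg σ) :
    FreeAlgebra k (Gen k L X) →ₐ[k] (ASigma T deg σ)ᵐᵒᵖ :=
  FreeAlgebra.lift k fun
    | .base ξ => baseAnti T deg σ ξ
    | .gen a b => op (g a b)
    | .inv a b => op (h a b)

variable (g h : X → X → ASigma T deg σ)

@[simp] theorem freeAnti_base (ξ : L ⊗[k] Lᵐᵒᵖ) :
    freeAnti T deg σ g h (FreeGen.base X ξ) = baseAnti T deg σ ξ := by simp [freeAnti]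

@[simp] theorem freeAnti_gen (a b : X) :
    freeAnti T deg σ g h (FreeGen.gen k L a b) = op (g a b) := by simp [freeAnti]

@[simp] theorem freeAnti_inv (a b : X) :
    freeAnti T deg σ g h (FreeGen.inv k L a b) = op (h a b) := by simp [freeAnti]

@[simp] theorem baseAnti_left (l : L) :
    baseAnti T deg σ (l ⊗ₜ 1) = op ((sourceTarget T deg σ).t (op l)) := by
  simp [baseAnti, AlgHom.opComm]

@[simp] theorem baseAnti_right (l : L) :
    baseAnti T deg σ (1 ⊗ₜ op l) = op ((sourceTarget T deg σ).s l) := by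
  simp [baseAnti, AlgHom.opComm]

/-- The relations between `g_{ab}` and `h_{ab}` that make `freeAnti` descend to `A_σ`. -/
structure AntiRelations : Prop where
  gen_inv : ∀ a b, ∑ c, h c b * g a c = if a = b then 1 else 0
  inv_gen : ∀ a b, ∑ c, g c b * h a c = if a = b then 1 else 0
  left_gen : ∀ f a b, g a b * (sourceTarget T deg σ).t (op (T (deg a) f))
    = (sourceTarget T deg σ).t (op f) * g a b
  right_gen : ∀ f a b, g a b * (sourceTarget T deg σ).s (T (deg b) f)
    = (sourceTarget T deg σ).s f * g a b
  left_inv : ∀ f a b, h a b * (sourceTarget T deg σ).t (op f)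
    = (sourceTarget T deg σ).t (op (T (deg b) f)) * h a b
  right_inv : ∀ f a b, h a b * (sourceTarget T deg σ).s f
    = (sourceTarget T deg σ).s (T (deg a) f) * h a b
  exchange : ∀ a b c d, ∑ x, ∑ y, g x b * g y d * (sourceTarget T deg σ).t (op (σ x y a c))
    = ∑ x, ∑ y, g a x * g c y * (sourceTarget T deg σ).s (σ b d x y)

variable {T deg σ g h}

theorem AntiRelations.freeAnti_eq (H : AntiRelations T deg σ g h)
    {x y : FreeAlgebra k (Gen k L X)} (hxy : SigmaRel T deg σ x y) :
    freeAnti T deg σ g h x = freeAnti T deg σ g h y := by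
  refine unop_injective ?_
  cases hxy with
  | base_add ξ η => simp
  | base_smul c ξ => simp
  | base_mul ξ η => simp
  | base_one => simp [← Algebra.TensorProduct.one_def]
  | gen_inv a b => simp [H.gen_inv, apply_ite unop]
  | inv_gen a b => simp [H.inv_gen, apply_ite unop]
  | left_gen f a b => simp [H.left_gen]
  | right_gen f a b => simp [H.right_gen]
  | left_inv f a b => simp [H.left_inv]
  | right_inv f a b => simp [H.right_inv]
  | exchange a b c d => simpa [mul_assoc] using H.exchange a b c d

/-- The anti-endomorphism of `A_σ` that exchanges `s` and `t` and takes `L_{ab}` to `g_{ab}` and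
`(L⁻¹)_{ab}` to `h_{ab}`. -/
def AntiRelations.hom (H : AntiRelations T deg σ g h) :
    ASigma T deg σ →ₐ[k] (ASigma T deg σ)ᵐᵒᵖ :=
  desc T deg σ (freeAnti T deg σ g h) fun _ _ => H.freeAnti_eq

variable (H : AntiRelations T deg σ g h)

@[simp] theorem AntiRelations.hom_s (l : L) :
    H.hom ((sourceTarget T deg σ).s l) = op ((sourceTarget T deg σ).t (op l)) :=
  (desc_proj T deg σ _ _ (FreeGen.base X (l ⊗ₜ 1))).trans (by simp)

@[simp] theorem AntiRelations.hom_t (l : L) :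
    H.hom ((sourceTarget T deg σ).t (op l)) = op ((sourceTarget T deg σ).s l) :=
  (desc_proj T deg σ _ _ (FreeGen.base X (1 ⊗ₜ op l))).trans (by simp)

@[simp] theorem AntiRelations.hom_gen (a b : X) : H.hom (gen T deg σ a b) = op (g a b) :=
  (desc_proj T deg σ _ _ (FreeGen.gen k L a b)).trans (by simp)

@[simp] theorem AntiRelations.hom_inv (a b : X) : H.hom (inv T deg σ a b) = op (h a b) :=
  (desc_proj T deg σ _ _ (FreeGen.inv k L a b)).trans (by simp)

end AntiHom

/-! ### Existence of the antipode from rigidity -/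

section Antipode

variable {T deg σ} [Group G]

/-- An anti-homomorphism reverses products, so what is needed is an inverse of the transpose of L⁻¹,
and x is one up to transposition. The linearity relations for x follow by inverting those of L⁻¹,
while the exchange relation comes from that of L by passing to L⁻¹. -/
theorem antiRelations_inv (hT : ∀ α f, T α (T α⁻¹ f) = f) (hσ : RightCondition T deg σ)
    {x : X → X → ASigma T deg σ}
    (h₁ : ∀ a b, ∑ c, inv T deg σ c b * x a c = if a = b then 1 else 0)
    (h₂ : ∀ a b, ∑ c, x c b * inv T deg σ a c = if a = b then 1 else 0) :
    AntiRelations T deg σ (inv T deg σ) x where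
  gen_inv := h₂
  inv_gen := h₁
  left_gen f a b := (t_inv T deg σ f a b).symm
  right_gen f a b := (s_inv T deg σ f a b).symm
  left_inv f a b :=
    inverse_mul_of_col (u := fun a b => inv T deg σ b a) (v := fun a b => x b a)
      (q := fun c => (sourceTarget T deg σ).t (op (T (deg c) f)))
      (fun a b => by simpa only [eq_comm] using h₁ b a)
      (fun a b => by simpa only [eq_comm] using h₂ b a) (fun a c => t_inv T deg σ f c a) b a
  right_inv f a b := by
    have hT' : ∀ α f, T α⁻¹ (T α f) = f := fun α f => by simpa using hT α⁻¹ f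
    have := mul_inverse_of_row (u := fun a b => inv T deg σ b a) (v := fun a b => x b a)
      (p := fun c => (sourceTarget T deg σ).s (T (deg c)⁻¹ (T (deg a) f)))
      (q := (sourceTarget T deg σ).s (T (deg a) f))
      (fun a b => by simpa only [eq_comm] using h₁ b a)
      (fun a b => by simpa only [eq_comm] using h₂ b a) (fun d c => by rw [s_inv, hT]) b a
    rw [this, hT']
  exchange a b c d := by
    refine (inverse_exchange (gen_mul_inv T deg σ) (inv_mul_gen T deg σ)
      (θ := fun f => (sourceTarget T deg σ).t (op f)) (φ := fun a => T (deg a))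
      (ψ := fun a => T (deg a)⁻¹) (τ := σ)
      (ω := fun x y a c => (sourceTarget T deg σ).s (σ x y a c))
      (fun a b f => ?_) (fun a b f => t_inv T deg σ f a b) (fun b d p q => ?_)
      (gen_exchange T deg σ) a c b d).symm
    · rw [t_inv, hT]
    -- At f = 1 the right bialgebroid condition says that the two composites of inverse twists, for
    -- p, q and for b, d, agree on σ^{bd}_{pq}.
    · have := hσ p b q d 1
      rw [mul_one, one_mul] at this
      rw [this, hT, hT]

/-- Obtained by inverting the transpose of L in the relation between s(f) and L_{ab}. It serves a
linearity relation and both commutation hypotheses of the exchange relation in `antiRelations_gen`.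
-/
theorem mul_s_of_antiInverse (hT : ∀ α f, T α (T α⁻¹ f) = f) {y : X → X → ASigma T deg σ}
    (h₁ : ∀ a b, ∑ c, gen T deg σ c b * y a c = if a = b then 1 else 0)
    (h₂ : ∀ a b, ∑ c, y c b * gen T deg σ a c = if a = b then 1 else 0) (f : L) (a b : X) :
    y a b * (sourceTarget T deg σ).s f = (sourceTarget T deg σ).s (T (deg b)⁻¹ f) * y a b :=
  inverse_mul_of_col (u := fun a b => gen T deg σ b a) (v := fun a b => y b a)
    (q := fun c => (sourceTarget T deg σ).s (T (deg c)⁻¹ f))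
    (fun a b => by simpa only [eq_comm] using h₁ b a)
    (fun a b => by simpa only [eq_comm] using h₂ b a) (fun a c => by rw [← s_gen, hT]) b a

theorem antiRelations_gen (hT : ∀ α f, T α (T α⁻¹ f) = f) (hσ : RightCondition T deg σ)
    {y : X → X → ASigma T deg σ}
    (h₁ : ∀ a b, ∑ c, gen T deg σ c b * y a c = if a = b then 1 else 0)
    (h₂ : ∀ a b, ∑ c, y c b * gen T deg σ a c = if a = b then 1 else 0) :
    AntiRelations T deg σ y (gen T deg σ) where
  gen_inv := h₁
  inv_gen := h₂
  left_gen f a b :=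
    (mul_inverse_of_row (u := fun a b => gen T deg σ b a) (v := fun a b => y b a)
      (p := fun c => (sourceTarget T deg σ).t (op (T (deg c) f)))
      (fun a b => by simpa only [eq_comm] using h₁ b a)
      (fun a b => by simpa only [eq_comm] using h₂ b a)
      (fun d c => (t_gen T deg σ f c d).symm) b a).symm
  right_gen f a b := by
    have := mul_s_of_antiInverse hT h₁ h₂ (T (deg b) f) a b
    rwa [show T (deg b)⁻¹ (T (deg b) f) = f by simpa using hT (deg b)⁻¹ f] at this
  left_inv f a b := (t_gen T deg σ f a b).symm
  right_inv f a b := (s_gen T deg σ f a b).symm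
  exchange a b c d := by
    -- The defining exchange relation is read from right to left for the transpose of L: the upper
    -- and lower indices of σ change places, and s takes the role that t has in `antiRelations_inv`.
    refine inverse_exchange (u := fun a b => gen T deg σ b a) (v := fun a b => y b a)
      (fun a b => by simpa only [eq_comm] using h₁ b a)
      (fun a b => by simpa only [eq_comm] using h₂ b a)
      (θ := (sourceTarget T deg σ).s) (φ := fun a => T (deg a)) (ψ := fun a => T (deg a)⁻¹)
      (τ := fun b d p q => σ p q b d)
      (ω := fun x y a c => (sourceTarget T deg σ).t (op (σ a c x y)))
      (fun a b f => mul_s_of_antiInverse hT h₁ h₂ f b a) (fun a b f => ?_) (fun b d p q => ?_)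
      (fun a b c d => (gen_exchange T deg σ b a d c).symm) b d a c
    · rw [mul_s_of_antiInverse hT h₁ h₂,
        show T (deg a)⁻¹ (T (deg a) f) = f by simpa using hT (deg a)⁻¹ f]
    · have := hσ b p d q 1
      rw [mul_one, one_mul] at this
      rw [← this, hT, hT]

/-- Rigidity gives the anti-automorphism. -/
theorem Rigid.exists_isAntipode (hT : ∀ α f, T α (T α⁻¹ f) = f) (hσ : RightCondition T deg σ)
    (h : Rigid T deg σ) :
    ∃ S : ASigma T deg σ ≃ₐ[k] (ASigma T deg σ)ᵐᵒᵖ, IsAntipode T deg σ S := by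
  obtain ⟨x, y, hxy⟩ := h
  let H := antiRelations_inv hT hσ (fun a b => (hxy a b).1) (fun a b => (hxy a b).2.1)
  let H' := antiRelations_gen hT hσ (fun a b => (hxy a b).2.2.1) (fun a b => (hxy a b).2.2.2)
  -- Here L_{ab} goes to (L⁻¹)_{ab} and back by construction, whereas (L⁻¹)_{ab} passes through
  -- x_{ab}; uniqueness of inverses settles it. In `h₂` the two matrices exchange roles.
  have h₁ : (AlgHom.opComm H'.hom).comp H.hom = AlgHom.id k _ := by
    have hgen : ∀ a b, (AlgHom.opComm H'.hom).comp H.hom (gen T deg σ a b)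
        = AlgHom.id k _ (gen T deg σ a b) := fun a b => by simp
    exact algHom_ext (fun l => by simp) (fun l => by simp) hgen (map_inv_eq_of_map_gen_eq hgen)
  have h₂ : (AlgHom.opComm H.hom).comp H'.hom = AlgHom.id k _ := by
    have hinv : ∀ a b, (AlgHom.opComm H.hom).comp H'.hom (inv T deg σ a b)
        = AlgHom.id k _ (inv T deg σ a b) := fun a b => by simp
    exact algHom_ext (fun l => by simp) (fun l => by simp) (map_gen_eq_of_map_inv_eq hinv) hinv
  have hS : ∀ a, H.hom ((AlgHom.opComm H'.hom) a) = a := fun a => by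
    have := DFunLike.congr_fun h₂ (unop a)
    refine unop_injective ?_
    simpa using this
  refine ⟨AlgEquiv.ofAlgHom H.hom (AlgHom.opComm H'.hom) (AlgHom.ext hS) h₁, ?_, ?_, ?_⟩
  · intro f; simp [antiMap]
  · intro f; simp [antiMap]
  · intro a b; simp [antiMap]

end Antipode

end ASigma

/-! ### Right multiplicative maps -/

section RightMultiplicative

variable {A C V X : Type*} [Ring A] [Ring C] [AddCommGroup V] [Fintype X] [DecidableEq X]

/-- Along `p : C → V`, the map `D : A → V` turns right multiplication by `b` into right
multiplication by `w`. -/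
def RightMultiplicative (p : C →+ V) (D : A →+ V) (b : A) (w : C) : Prop :=
  ∀ a z, D a = p z → D (a * b) = p (z * w)

/-- If `D` is right multiplicative for the entries of a matrix, then also for those of its
inverse. -/
theorem RightMultiplicative.of_inverse {p : C →+ V} {D : A →+ V} (hp : Function.Surjective p)
    {u v : X → X → A} {u' v' : X → X → C}
    (huv : ∀ a b, ∑ c, u a c * v c b = if a = b then 1 else 0)
    (hvu' : ∀ a b, ∑ c, v' a c * u' c b = if a = b then 1 else 0)
    (hu' : ∀ a b z, p z = 0 → p (z * u' a b) = 0)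
    (hv : ∀ a b, RightMultiplicative p D (v a b) (v' a b)) (a b : X) :
    RightMultiplicative p D (u a b) (u' a b) := by
  intro y z hz
  -- Arbitrary lifts of D(y u_{ac}); the goal becomes that ζ_b − z u'_{ab} lies in the kernel of p.
  choose ζ hζ using fun c => hp (D (y * u a c))
  -- Right multiplicativity for v makes the product of ζ with v' represent D(y u v), which is D(y)
  -- or 0. Multiplication by u', which preserves the kernel, then cancels v'.
  have h₁ : ∀ f, p (∑ c, ζ c * v' c f - if a = f then z else 0) = 0 := by
    intro f
    rw [map_sub, map_sum, ← Finset.sum_congr rfl fun c _ => hv c f _ _ (hζ c).symm]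
    simp only [mul_assoc, ← map_sum, ← Finset.mul_sum, huv]
    split_ifs <;> simp [hz]
  have h₂ : p (∑ f, (∑ c, ζ c * v' c f - if a = f then z else 0) * u' f b) = 0 := by
    rw [map_sum]
    exact Finset.sum_eq_zero fun f _ => hu' f b _ (h₁ f)
  have h₃ : ∑ f, (∑ c, ζ c * v' c f - if a = f then z else 0) * u' f b = ζ b - z * u' a b := by
    simp only [sub_mul, Finset.sum_sub_distrib, Finset.sum_mul, mul_assoc]
    rw [Finset.sum_comm]
    simp [← Finset.mul_sum, hvu', ite_mul]
  rw [h₃, map_sub, sub_eq_zero, hζ] at h₂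
  exact h₂

end RightMultiplicative

/-! ### The flip by an anti-homomorphism -/

section FlipMap

variable {k A : Type*} [CommRing k] [Ring A] [Algebra k A]

/-- The map `m ⊗ n ↦ f(n) ⊗ f(m)`. -/
def flipMap (f : A →ₗ[k] A) : A ⊗[k] A →ₗ[k] A ⊗[k] A :=
  (TensorProduct.map f f).comp (TensorProduct.comm k A A).toLinearMap

@[simp] theorem flipMap_tmul (f : A →ₗ[k] A) (m n : A) :
    flipMap f (m ⊗ₜ n) = f n ⊗ₜ f m := by
  simp [flipMap]

theorem flipMap_mul {f : A →ₗ[k] A} (hf : ∀ a b, f (a * b) = f b * f a) (x y : A ⊗[k] A) :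
    flipMap f (x * y) = flipMap f y * flipMap f x := by
  induction x using TensorProduct.induction_on with
  | zero => simp
  | add x x' hx hx' => simp only [add_mul, map_add, hx, hx', mul_add]
  | tmul m n =>
    induction y using TensorProduct.induction_on with
    | zero => simp
    | add y y' hy hy' => simp only [mul_add, map_add, hy, hy', add_mul]
    | tmul m' n' => simp [hf]

@[simp] theorem antiMap_one (S : A ≃ₐ[k] Aᵐᵒᵖ) : antiMap S 1 = 1 := by simp [antiMap]

@[simp] theorem antiInv_one (S : A ≃ₐ[k] Aᵐᵒᵖ) : antiInv S 1 = 1 := by simp [antiInv]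

@[simp] theorem antiInv_mul (S : A ≃ₐ[k] Aᵐᵒᵖ) (a b : A) :
    antiInv S (a * b) = antiInv S b * antiInv S a := by simp [antiInv]

theorem antiMap_ite_one (S : A ≃ₐ[k] Aᵐᵒᵖ) (P : Prop) [Decidable P] :
    antiMap S (if P then 1 else 0) = if P then 1 else 0 := by split_ifs <;> simp

end FlipMap

namespace ASigma

variable {k L G X : Type*} [CommRing k] [Ring L] [Algebra k L] [Fintype X] [DecidableEq X]
  {T : G → L ≃ₐ[k] L} {deg : X → G} {σ : X → X → X → X → L}

namespace IsAntipode

variable {S : ASigma T deg σ ≃ₐ[k] (ASigma T deg σ)ᵐᵒᵖ}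
  {L' : Type*} [Ring L'] (ν : Lᵐᵒᵖ ≃+* L')

theorem inv_s (hS : IsAntipode T deg σ S) (f : L) :
    antiInv S ((sourceTarget T deg σ).s f) = (sourceTarget T deg σ).t (op f) := by
  rw [← hS.map_t, antiInv_antiMap]

theorem inv_t (hS : IsAntipode T deg σ S) (f : L) :
    antiInv S ((sourceTarget T deg σ).t (op f)) = (sourceTarget T deg σ).s f := by
  rw [← hS.map_s, antiInv_antiMap]

theorem inv_inv (hS : IsAntipode T deg σ S) (a b : X) :
    antiInv S (inv T deg σ a b) = gen T deg σ a b := by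
  rw [← hS.map_gen, antiInv_antiMap]

/-! #### The balancing relations over `L'` -/

/-- Since S ∘ s = t, both L'-actions are right multiplications by t(l) and s(l), and ν drops out of
the relations. -/
theorem rel'_gen (hS : IsAntipode T deg σ S) (l : L) (m n : ASigma T deg σ) :
    (m * (sourceTarget T deg σ).t (op l)) ⊗ₜ[k] n - m ⊗ₜ[k] (n * (sourceTarget T deg σ).s l)
      ∈ balancedRel ((sourceTarget T deg σ).ract' S ν) ((sourceTarget T deg σ).lact' ν) :=
  Submodule.subset_span ⟨ν (op l), m, n, by
    simp [SourceTarget.ract', SourceTarget.lact', hS.map_s]⟩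

theorem rel'_induction (hS : IsAntipode T deg σ S)
    {N : Submodule k (ASigma T deg σ ⊗[k] ASigma T deg σ)}
    (h : ∀ l m n, (m * (sourceTarget T deg σ).t (op l)) ⊗ₜ[k] n
      - m ⊗ₜ[k] (n * (sourceTarget T deg σ).s l) ∈ N) :
    balancedRel ((sourceTarget T deg σ).ract' S ν) ((sourceTarget T deg σ).lact' ν) ≤ N := by
  refine Submodule.span_le.2 ?_
  rintro _ ⟨r, m, n, rfl⟩
  simpa [SourceTarget.ract', SourceTarget.lact', hS.map_s] using h (unop (ν.symm r)) m n

/-- L' acts by right multiplications, so the relations form a left ideal, whereas `relL` is a right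
ideal. Compatibility on the right has to be checked for each letter. -/
theorem mul_rel' (hS : IsAntipode T deg σ S) (w z : ASigma T deg σ ⊗[k] ASigma T deg σ)
    (hz : z ∈ balancedRel ((sourceTarget T deg σ).ract' S ν) ((sourceTarget T deg σ).lact' ν)) :
    w * z ∈ balancedRel ((sourceTarget T deg σ).ract' S ν) ((sourceTarget T deg σ).lact' ν) := by
  induction w using TensorProduct.induction_on with
  | zero => simp
  | add x y hx hy => rw [add_mul]; exact add_mem hx hy
  | tmul u v =>
    refine hS.rel'_induction ν (N := Submodule.comap (LinearMap.mulLeft k (u ⊗ₜ[k] v))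
      (balancedRel ((sourceTarget T deg σ).ract' S ν) ((sourceTarget T deg σ).lact' ν))) ?_ hz
    intro l m n
    simpa [mul_sub, mul_assoc] using hS.rel'_gen ν l (u * m) (v * n)

theorem rel'_mul (hS : IsAntipode T deg σ S) (w : ASigma T deg σ ⊗[k] ASigma T deg σ)
    (hw : ∀ l, ((sourceTarget T deg σ).t (op l) ⊗ₜ[k] 1) * w
      - (1 ⊗ₜ[k] (sourceTarget T deg σ).s l) * w
      ∈ balancedRel ((sourceTarget T deg σ).ract' S ν) ((sourceTarget T deg σ).lact' ν))
    (z : ASigma T deg σ ⊗[k] ASigma T deg σ)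
    (hz : z ∈ balancedRel ((sourceTarget T deg σ).ract' S ν) ((sourceTarget T deg σ).lact' ν)) :
    z * w ∈ balancedRel ((sourceTarget T deg σ).ract' S ν) ((sourceTarget T deg σ).lact' ν) := by
  refine hS.rel'_induction ν (N := Submodule.comap (LinearMap.mulRight k w)
    (balancedRel ((sourceTarget T deg σ).ract' S ν) ((sourceTarget T deg σ).lact' ν))) ?_ hz
  intro l m n
  simpa [mul_sub, sub_mul, ← mul_assoc] using hS.mul_rel' ν (m ⊗ₜ n) _ (hw l)

theorem mk'_eq_zero {z : ASigma T deg σ ⊗[k] ASigma T deg σ} :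
    BalTensor.mk ((sourceTarget T deg σ).ract' S ν) ((sourceTarget T deg σ).lact' ν) z = 0
      ↔ z ∈ balancedRel ((sourceTarget T deg σ).ract' S ν) ((sourceTarget T deg σ).lact' ν) :=
  Submodule.Quotient.mk_eq_zero _

/-- Right multiplication by the comultiplication of a letter preserves the balancing relations
over `L'`. -/
theorem mk'_mul_evalComul_ι (hS : IsAntipode T deg σ S) [Group G]
    (hT : ∀ α f, T α (T α⁻¹ f) = f) (v : Letter L X)
    (z : ASigma T deg σ ⊗[k] ASigma T deg σ)
    (hz : BalTensor.mk ((sourceTarget T deg σ).ract' S ν) ((sourceTarget T deg σ).lact' ν) z = 0) :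
    BalTensor.mk ((sourceTarget T deg σ).ract' S ν) ((sourceTarget T deg σ).lact' ν)
      (z * evalComul T deg σ (FreeAlgebra.ι k v)) = 0 := by
  rw [mk'_eq_zero] at hz ⊢
  refine hS.rel'_mul ν _ (fun l => ?_) z hz
  cases v with
  | src f =>
    have := hS.rel'_gen ν l ((sourceTarget T deg σ).s f) 1
    simpa [(sourceTarget T deg σ).comm] using this
  | tgt f =>
    have := hS.rel'_gen ν l 1 ((sourceTarget T deg σ).t (op f))
    simpa [(sourceTarget T deg σ).comm] using this
  | gen a b =>
    rw [evalComul_gen, Finset.mul_sum, Finset.mul_sum, ← Finset.sum_sub_distrib]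
    refine sum_mem fun c _ => ?_
    -- The middle index c is the column of the first factor and the row of the second, so t on the
    -- first and s on the second are twisted by the same T_{deg c}; its inverse in the scalar
    -- compensates.
    have := hS.rel'_gen ν (T (deg c)⁻¹ l) (gen T deg σ a c) (gen T deg σ c b)
    rw [← t_gen, ← s_gen, hT] at this
    simpa using this
  | inv a b =>
    rw [evalComul_inv, Finset.mul_sum, Finset.mul_sum, ← Finset.sum_sub_distrib]
    refine sum_mem fun c _ => ?_
    have := hS.rel'_gen ν (T (deg c) l) (inv T deg σ c b) (inv T deg σ a c)
    rw [← t_inv, ← s_inv] at this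
    simpa using this

/-! #### Comultiplications over `L'` -/

/-- The sum over c contracts the second tensor factors, which forces the two inner indices to agree;
the first factors then contract. The identity holds already over k, as
`RightMultiplicative.of_inverse` requires of the matrices u' and v'. -/
theorem evalComul_gen_mul_inv (a b : X) :
    ∑ c, evalComul T deg σ (FreeAlgebra.ι k (.gen a c))
      * evalComul T deg σ (FreeAlgebra.ι k (.inv c b)) = if a = b then 1 else 0 := by
  simp only [evalComul_gen, evalComul_inv, Finset.sum_mul, Finset.mul_sum,
    Algebra.TensorProduct.tmul_mul_tmul]
  rw [Finset.sum_comm]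
  have : ∀ e, ∑ c, ∑ f, (gen T deg σ a f * inv T deg σ e b) ⊗ₜ[k]
      (gen T deg σ f c * inv T deg σ c e) = (gen T deg σ a e * inv T deg σ e b) ⊗ₜ[k] 1 := by
    intro e
    rw [Finset.sum_comm]
    simp only [← TensorProduct.tmul_sum, gen_mul_inv]
    simp [TensorProduct.tmul_ite]
  simp only [this, ← TensorProduct.sum_tmul, gen_mul_inv]
  split_ifs <;> simp [Algebra.TensorProduct.one_def]

theorem evalComul_inv_mul_gen (a b : X) :
    ∑ c, evalComul T deg σ (FreeAlgebra.ι k (.inv a c))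
      * evalComul T deg σ (FreeAlgebra.ι k (.gen c b)) = if a = b then 1 else 0 := by
  simp only [evalComul_gen, evalComul_inv, Finset.sum_mul, Finset.mul_sum,
    Algebra.TensorProduct.tmul_mul_tmul]
  rw [Finset.sum_comm]
  have : ∀ f, ∑ c, ∑ e, (inv T deg σ e c * gen T deg σ c f) ⊗ₜ[k]
      (inv T deg σ a e * gen T deg σ f b) = 1 ⊗ₜ[k] (inv T deg σ a f * gen T deg σ f b) := by
    intro f
    rw [Finset.sum_comm]
    simp only [← TensorProduct.sum_tmul, inv_mul_gen]
    simp [TensorProduct.ite_tmul]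
  simp only [this, ← TensorProduct.tmul_sum, inv_mul_gen]
  split_ifs <;> simp [Algebra.TensorProduct.one_def]

variable {ν}

theorem apply_eval_of_rightMultiplicative
    {D : ASigma T deg σ →ₗ[k] (sourceTarget T deg σ).TensorL' S ν}
    (h₁ : D 1 = BalTensor.mk _ _ 1)
    (hD : ∀ v : Letter L X, RightMultiplicative
      (BalTensor.mk ((sourceTarget T deg σ).ract' S ν)
        ((sourceTarget T deg σ).lact' ν)).toAddMonoidHom D.toAddMonoidHom
      (eval T deg σ (FreeAlgebra.ι k v)) (evalComul T deg σ (FreeAlgebra.ι k v)))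
    (w : LetterAlg k L X) : D (eval T deg σ w) = BalTensor.mk _ _ (evalComul T deg σ w) := by
  -- An arbitrary left factor a, with an arbitrary representative z, lets the induction pass through
  -- products; a = 1 gives the claim.
  have : ∀ a z, D a = BalTensor.mk _ _ z →
      D (a * eval T deg σ w) = BalTensor.mk _ _ (z * evalComul T deg σ w) := by
    induction w using FreeAlgebra.induction with
    | grade0 r =>
      intro a z h
      rw [AlgHom.commutes, AlgHom.commutes, ← Algebra.commutes, ← Algebra.commutes,
        ← Algebra.smul_def, ← Algebra.smul_def, map_smul, map_smul, h]
    | grade1 v => exact hD v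
    | mul x y hx hy =>
      intro a z h
      rw [map_mul (eval T deg σ), map_mul (evalComul T deg σ), ← mul_assoc, ← mul_assoc]
      exact hy _ _ (hx _ _ h)
    | add x y hx hy =>
      intro a z h
      rw [map_add (eval T deg σ), map_add (evalComul T deg σ), mul_add, mul_add, map_add, map_add,
        hx _ _ h, hy _ _ h]
  simpa using this 1 1 h₁

variable [Group G] (hT : ∀ α f, T α (T α⁻¹ f) = f)

/-- The anti-map f' turns right multiplication by f(w) into left multiplication by w, where Δ_L is
under control, and the flip by f turns it back. The hypothesis `hw` removes the dependence on the
representative z. -/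
theorem rightMultiplicative_conj {f f' : ASigma T deg σ →ₗ[k] ASigma T deg σ}
    (hf : ∀ a b, f (a * b) = f b * f a) (hf' : ∀ a b, f' (a * b) = f' b * f' a)
    (hff' : ∀ a, f' (f a) = a)
    {U : (sourceTarget T deg σ).TensorL →ₗ[k] (sourceTarget T deg σ).TensorL' S ν}
    (hU : ∀ z, U (BalTensor.mk _ _ z) = BalTensor.mk _ _ (flipMap f z)) (w : LetterAlg k L X)
    (hw : ∀ z, BalTensor.mk ((sourceTarget T deg σ).ract' S ν)
        ((sourceTarget T deg σ).lact' ν) z = 0 →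
      BalTensor.mk ((sourceTarget T deg σ).ract' S ν) ((sourceTarget T deg σ).lact' ν)
        (z * flipMap f (evalComul T deg σ w)) = 0) :
    RightMultiplicative
      (BalTensor.mk ((sourceTarget T deg σ).ract' S ν)
        ((sourceTarget T deg σ).lact' ν)).toAddMonoidHom
      (U.comp ((comul T deg σ hT).comp f')).toAddMonoidHom
      (f (eval T deg σ w)) (flipMap f (evalComul T deg σ w)) := by
  intro a z hz
  obtain ⟨z₀, hz₀⟩ := BalTensor.mk_surjective _ _ (comul T deg σ hT (f' a))
  have h := comul_eval_mul T deg σ hT w (f' a) z₀ hz₀.symm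
  simp only [LinearMap.toAddMonoidHom_coe, LinearMap.comp_apply] at hz ⊢
  rw [← hz₀, hU] at hz
  rw [hf', hff', h, hU, flipMap_mul hf, ← sub_eq_zero, ← map_sub, ← sub_mul]
  exact hw _ (by rw [map_sub, hz, sub_self])

/-- Conjugation by S handles every letter that is S of a letter. The remaining L_{ab} are reached
through their inverse matrix, as no formula for S((L⁻¹)_{ab}) is available. -/
theorem Δ'_eval (hS : IsAntipode T deg σ S) (w : LetterAlg k L X) :
    (sourceTarget T deg σ).Δ' S ν hS.map_t (comul T deg σ hT) (eval T deg σ w)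
      = BalTensor.mk _ _ (evalComul T deg σ w) := by
  have hst := hS.mk'_mul_evalComul_ι ν hT
  have hU : ∀ z, (sourceTarget T deg σ).twistL S ν hS.map_t (BalTensor.mk _ _ z)
      = BalTensor.mk _ _ (flipMap (antiMap S) z) := by
    intro z
    induction z using TensorProduct.induction_on with
    | zero => simp
    | add x y hx hy => simp only [map_add, hx, hy]
    | tmul m n => exact (SourceTarget.twistL_tmul _ S ν hS.map_t m n).trans (by simp)
  have key := rightMultiplicative_conj hT (antiMap_mul S) (antiInv_mul S) (antiInv_antiMap S) hU
  have hinv : ∀ a b : X, RightMultiplicative _ _ (eval T deg σ (FreeAlgebra.ι k (.inv a b)))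
      (evalComul T deg σ (FreeAlgebra.ι k (.inv a b))) := fun a b => by
    -- S reverses the order of the tensor factors, so the flipped comultiplication of L_{ab} is
    -- exactly that of (L⁻¹)_{ab}.
    have := key (FreeAlgebra.ι k (.gen a b))
    simp only [eval_gen, hS.map_gen, evalComul_gen, map_sum, flipMap_tmul] at this
    rw [eval_inv, evalComul_inv]
    refine this fun z hz => ?_
    rw [← evalComul_inv]
    exact hst _ z hz
  refine apply_eval_of_rightMultiplicative ?_ (fun v => ?_) w
  · have := comul_eval T deg σ hT 1
    rw [map_one (eval T deg σ), map_one (evalComul T deg σ)] at this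
    simp only [SourceTarget.Δ', LinearMap.comp_apply, antiInv_one]
    rw [this, hU, Algebra.TensorProduct.one_def, flipMap_tmul, antiMap_one]
  · cases v with
    | inv a b => exact hinv a b
    | gen a b =>
      refine RightMultiplicative.of_inverse (BalTensor.mk_surjective _ _)
        (u := fun a b => eval T deg σ (FreeAlgebra.ι k (.gen a b)))
        (u' := fun a b => evalComul T deg σ (FreeAlgebra.ι k (.gen a b)))
        (by simpa using gen_mul_inv T deg σ) evalComul_inv_mul_gen (fun a b => hst _) hinv a b
    | src l =>
      have := key (FreeAlgebra.ι k (.tgt l))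
      simp only [eval_tgt, hS.map_t, evalComul_tgt, flipMap_tmul, antiMap_one] at this
      rw [eval_src, evalComul_src]
      refine this fun z hz => ?_
      rw [← evalComul_src]
      exact hst _ z hz
    | tgt l =>
      have := key (FreeAlgebra.ι k (.src l))
      simp only [eval_src, hS.map_s, evalComul_src, flipMap_tmul, antiMap_one] at this
      rw [eval_tgt, evalComul_tgt]
      refine this fun z hz => ?_
      rw [← evalComul_tgt]
      exact hst _ z hz

/-! ### The flip as an isomorphism, and the second conjugate of Δ_L -/

variable (ν) in
/-- The isomorphism `A ⊗_{L'} A → A ⊗_L A`, `a ⊗ b ↦ S(b) ⊗ S(a)`. -/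
def twistEquiv (hS : IsAntipode T deg σ S) :
    (sourceTarget T deg σ).TensorL' S ν ≃ₗ[k] (sourceTarget T deg σ).TensorL :=
  LinearEquiv.ofLinearMap
    (Submodule.mapQ _ _ (flipMap (antiMap S)) (hS.rel'_induction ν fun l m n => by
      -- The flip interchanges the two terms of a balancing relation, hence the sign.
      have := neg_mem ((sourceTarget T deg σ).relL_gen l (antiMap S n) (antiMap S m))
      simpa [hS.map_s, hS.map_t] using this))
    (Submodule.mapQ _ _ (flipMap (antiInv S)) (Submodule.span_le.2 (by
      rintro _ ⟨l, m, n, rfl⟩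
      have := neg_mem (hS.rel'_gen ν l (antiInv S n) (antiInv S m))
      simpa [hS.inv_s, hS.inv_t, SourceTarget.ract, SourceTarget.lact] using this)))
    (by
      refine SourceTarget.end_ext _ fun z => ?_
      change BalTensor.mk _ _ (flipMap (antiMap S) (flipMap (antiInv S) z)) = BalTensor.mk _ _ z
      congr 1
      induction z using TensorProduct.induction_on with
      | zero => simp
      | add x y hx hy => simp only [map_add, hx, hy]
      | tmul m n => simp)
    (by
      refine LinearMap.ext fun z => ?_
      obtain ⟨z, rfl⟩ := BalTensor.mk_surjective _ _ z
      change BalTensor.mk _ _ (flipMap (antiInv S) (flipMap (antiMap S) z)) = BalTensor.mk _ _ z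
      congr 1
      induction z using TensorProduct.induction_on with
      | zero => simp
      | add x y hx hy => simp only [map_add, hx, hy]
      | tmul m n => simp)

variable (ν) in
theorem twistEquiv_tmul (hS : IsAntipode T deg σ S) (a b : ASigma T deg σ) :
    hS.twistEquiv ν (BalTensor.tmul _ _ a b)
      = BalTensor.tmul _ _ (antiMap S b) (antiMap S a) :=
  congrArg (BalTensor.mk _ _) (flipMap_tmul (antiMap S) a b)

variable (ν) in
theorem twistEquiv_symm_mk (hS : IsAntipode T deg σ S) (z : ASigma T deg σ ⊗[k] ASigma T deg σ) :
    (hS.twistEquiv ν).symm (BalTensor.mk _ _ z) = BalTensor.mk _ _ (flipMap (antiInv S) z) :=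
  rfl

/-- Mirror image of `Δ'_eval`: now S⁻¹((L⁻¹)_{ab}) = L_{ab} is the known value, and (L⁻¹)_{ab} is
reached by matrix inversion. Equal representatives identify the two conjugates of Δ_L. -/
theorem twistEquiv_symm_eval (hS : IsAntipode T deg σ S) (w : LetterAlg k L X) :
    (hS.twistEquiv ν).symm (comul T deg σ hT (antiMap S (eval T deg σ w)))
      = BalTensor.mk _ _ (evalComul T deg σ w) := by
  have hst := hS.mk'_mul_evalComul_ι ν hT
  have key := rightMultiplicative_conj hT (antiInv_mul S) (antiMap_mul S) (antiMap_antiInv S)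
    (U := (hS.twistEquiv ν).symm.toLinearMap) (hS.twistEquiv_symm_mk ν)
  have hgen : ∀ a b : X, RightMultiplicative _ _ (eval T deg σ (FreeAlgebra.ι k (.gen a b)))
      (evalComul T deg σ (FreeAlgebra.ι k (.gen a b))) := fun a b => by
    have := key (FreeAlgebra.ι k (.inv a b))
    simp only [eval_inv, hS.inv_inv, evalComul_inv, map_sum, flipMap_tmul] at this
    rw [eval_gen, evalComul_gen]
    refine this fun z hz => ?_
    rw [← evalComul_gen]
    exact hst _ z hz
  refine apply_eval_of_rightMultiplicative (D := (hS.twistEquiv ν).symm.toLinearMap.comp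
    ((comul T deg σ hT).comp (antiMap S))) ?_ (fun v => ?_) w
  · have := comul_eval T deg σ hT 1
    rw [map_one (eval T deg σ), map_one (evalComul T deg σ)] at this
    simp only [LinearMap.comp_apply, antiMap_one, LinearEquiv.coe_coe]
    rw [this, twistEquiv_symm_mk, Algebra.TensorProduct.one_def, flipMap_tmul, antiInv_one]
  · cases v with
    | gen a b => exact hgen a b
    | inv a b =>
      refine RightMultiplicative.of_inverse (BalTensor.mk_surjective _ _)
        (u := fun a b => eval T deg σ (FreeAlgebra.ι k (.inv a b)))
        (u' := fun a b => evalComul T deg σ (FreeAlgebra.ι k (.inv a b)))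
        (by simpa using inv_mul_gen T deg σ) evalComul_gen_mul_inv (fun a b => hst _) hgen a b
    | src l =>
      have := key (FreeAlgebra.ι k (.tgt l))
      simp only [eval_tgt, hS.inv_t, evalComul_tgt, flipMap_tmul, antiInv_one] at this
      rw [eval_src, evalComul_src]
      refine this fun z hz => ?_
      rw [← evalComul_src]
      exact hst _ z hz
    | tgt l =>
      have := key (FreeAlgebra.ι k (.src l))
      simp only [eval_src, hS.inv_s, evalComul_src, flipMap_tmul, antiInv_one] at this
      rw [eval_tgt, evalComul_tgt]
      refine this fun z hz => ?_
      rw [← evalComul_tgt]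
      exact hst _ z hz

/-! #### The identity `S(a₁) a₂ = t(π(S(a)))` -/

theorem inv_mul_antiMap_inv (hS : IsAntipode T deg σ S) (a b : X) :
    ∑ c, antiMap S (inv T deg σ c b) * inv T deg σ a c = if a = b then 1 else 0 := by
  rw [← antiMap_ite_one S, ← gen_mul_inv, map_sum]
  simp [hS.map_gen]

variable (hσ : LeftCondition T deg σ)

/-- The value is forced although S((L⁻¹)_{ab}) is not explicit: ε is applied to the image under S of
L L⁻¹ = 1, and evaluation at T_{deg a}(f) isolates the term c = a. -/
theorem counitRep_antiMap_inv (hS : IsAntipode T deg σ S) (a b : X) (f : L) :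
    counitRep T deg σ hT hσ (antiMap S (inv T deg σ a b)) f = if a = b then T (deg a) f else 0 := by
  have h := DFunLike.congr_fun
    (congrArg (counitRep T deg σ hT hσ) (hS.inv_mul_antiMap_inv a b)) (T (deg a) f)
  have h' : T (deg a)⁻¹ (T (deg a) f) = f := by simpa using hT (deg a)⁻¹ f
  rw [map_sum, LinearMap.sum_apply] at h
  simp only [map_mul, Module.End.mul_apply, counitRep_inv, apply_ite, map_zero,
    Finset.sum_ite_eq, Finset.mem_univ, if_true, h'] at h
  rw [h]
  split_ifs <;> simp

variable (S) in
/-- The map `m ⊗ n ↦ S(m) n`. -/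
def _root_.ASigma.antipodeMul : ASigma T deg σ ⊗[k] ASigma T deg σ →ₗ[k] ASigma T deg σ :=
  TensorProduct.lift ((LinearMap.mul k (ASigma T deg σ)).comp (antiMap S))

@[simp] theorem antipodeMul_tmul (m n : ASigma T deg σ) :
    antipodeMul S (m ⊗ₜ n) = antiMap S m * n := rfl

/-- The scalar l stands between S(a₁) and a₂. In a product ab the inner factor a collapses first to
a new scalar t(ε(S(a))(l)), on which b then acts; this is why l and z must vary in the induction. -/
theorem antipodeMul_evalComul_mul (hS : IsAntipode T deg σ S) (w : LetterAlg k L X)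
    (z : ASigma T deg σ ⊗[k] ASigma T deg σ) (l : L) :
    antipodeMul S ((1 ⊗ₜ (sourceTarget T deg σ).t (op l)) * (evalComul T deg σ w * z))
      = antipodeMul S ((1 ⊗ₜ (sourceTarget T deg σ).t
          (op (counitRep T deg σ hT hσ (antiMap S (eval T deg σ w)) l))) * z) := by
  induction w using FreeAlgebra.induction generalizing z l with
  | grade0 r =>
    rw [AlgHom.commutes, AlgHom.commutes, Algebra.algebraMap_eq_smul_one,
      Algebra.algebraMap_eq_smul_one, map_smul, antiMap_one, map_smul, map_one]
    simp
  | mul a b ha hb =>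
    rw [map_mul (evalComul T deg σ), mul_assoc, ha, hb, map_mul (eval T deg σ), antiMap_mul,
      map_mul (counitRep T deg σ hT hσ), Module.End.mul_apply]
  | add a b ha hb =>
    rw [map_add (evalComul T deg σ), add_mul, mul_add, map_add, ha, hb, map_add (eval T deg σ),
      map_add, map_add, LinearMap.add_apply, op_add, map_add, TensorProduct.tmul_add, add_mul,
      map_add]
  | grade1 v =>
    induction z using TensorProduct.induction_on with
    | zero => simp
    | add x y hx hy => simp only [mul_add, map_add, hx, hy]
    | tmul m n =>
      cases v with
      | src f => simp [hS.map_s, mul_assoc]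
      | tgt f => simp [hS.map_t, mul_assoc]
      | gen a b =>
        -- The relation for t moves the scalar past L_{cb} with a twist by deg b, independent of c,
        -- so that the sum over c contracts to L⁻¹ L = 1.
        have h : ∀ c, antiMap S m * inv T deg σ a c
            * ((sourceTarget T deg σ).t (op l) * (gen T deg σ c b * n))
            = antiMap S m * (inv T deg σ a c * gen T deg σ c b)
              * ((sourceTarget T deg σ).t (op (T (deg b)⁻¹ l)) * n) := fun c => by
          have : (sourceTarget T deg σ).t (op l) * gen T deg σ c b
              = gen T deg σ c b * (sourceTarget T deg σ).t (op (T (deg b)⁻¹ l)) := by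
            rw [← t_gen, hT]
          rw [← mul_assoc ((sourceTarget T deg σ).t _), this]
          simp only [mul_assoc]
        simp only [eval_gen, hS.map_gen, counitRep_inv, evalComul_gen, Finset.sum_mul,
          Finset.mul_sum, Algebra.TensorProduct.tmul_mul_tmul, one_mul, map_sum, antipodeMul_tmul,
          antiMap_mul, h]
        simp only [← Finset.sum_mul, ← Finset.mul_sum, inv_mul_gen]
        by_cases hab : a = b
        · subst hab; simp
        · simp [hab]
      | inv a b =>
        have h : ∀ c, antiMap S m * antiMap S (inv T deg σ c b)
            * ((sourceTarget T deg σ).t (op l) * (inv T deg σ a c * n))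
            = antiMap S m * (antiMap S (inv T deg σ c b) * inv T deg σ a c)
              * ((sourceTarget T deg σ).t (op (T (deg a) l)) * n) := fun c => by
          rw [← mul_assoc ((sourceTarget T deg σ).t _), t_inv]
          simp only [mul_assoc]
        simp only [eval_inv, hS.counitRep_antiMap_inv, evalComul_inv, Finset.sum_mul,
          Finset.mul_sum, Algebra.TensorProduct.tmul_mul_tmul, one_mul, map_sum, antipodeMul_tmul,
          antiMap_mul, h]
        simp only [← Finset.sum_mul, ← Finset.mul_sum, hS.inv_mul_antiMap_inv]
        by_cases hab : a = b
        · subst hab; simp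
        · simp [hab]

/-! ### The Hopf algebroid axioms -/

theorem isHopfAlgebroid (hS : IsAntipode T deg σ S) :
    IsHopfAlgebroid (sourceTarget T deg σ) (comul T deg σ hT) (counit T deg σ hT hσ) S ν where
  toIsLeftBialgebroid := isLeftBialgebroid T deg σ hT hσ
  S_t := hS.map_t
  S_mul a := by
    obtain ⟨w, rfl⟩ := eval_surjective T deg σ a
    rw [comul_eval]
    -- At l = 1 and z = 1 the scalar ε(S(a))(1) is π(S(a)).
    have := hS.antipodeMul_evalComul_mul hT hσ w 1 1
    rw [op_one, map_one (sourceTarget T deg σ).t, ← Algebra.TensorProduct.one_def, one_mul, mul_one,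
      mul_one, antipodeMul_tmul, antiMap_one, one_mul] at this
    exact this
  Δ_lact' r a := by
    obtain ⟨z, hz⟩ := BalTensor.mk_surjective _ _ (comul T deg σ hT a)
    have := comul_mul_eval T deg σ hT (FreeAlgebra.ι k (.src (unop (ν.symm r)))) a z hz.symm
    rw [eval_src, evalComul_src] at this
    rw [← hz, SourceTarget.lact'L, BalTensor.actFst_mk, SourceTarget.lact', map_mulRight_id]
    exact this
  Δ_ract' r a := by
    obtain ⟨z, hz⟩ := BalTensor.mk_surjective _ _ (comul T deg σ hT a)
    have := comul_mul_eval T deg σ hT (FreeAlgebra.ι k (.tgt (unop (ν.symm r)))) a z hz.symm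
    rw [eval_tgt, evalComul_tgt, ← hS.map_s] at this
    rw [← hz, SourceTarget.ract'L, BalTensor.actSnd_mk, SourceTarget.ract', map_id_mulRight]
    exact this
  Δ'_lact l a := by
    obtain ⟨w, rfl⟩ := eval_surjective T deg σ a
    have := hS.Δ'_eval (ν := ν) hT (FreeAlgebra.ι k (.src l) * w)
    rw [map_mul (eval T deg σ), map_mul (evalComul T deg σ), eval_src, evalComul_src] at this
    rw [hS.Δ'_eval, SourceTarget.lactL', BalTensor.actFst_mk, SourceTarget.lact, map_mulLeft_id]
    exact this
  Δ'_ract l a := by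
    obtain ⟨w, rfl⟩ := eval_surjective T deg σ a
    have := hS.Δ'_eval (ν := ν) hT (FreeAlgebra.ι k (.tgt l) * w)
    rw [map_mul (eval T deg σ), map_mul (evalComul T deg σ), eval_tgt, evalComul_tgt] at this
    rw [hS.Δ'_eval, SourceTarget.ractL', BalTensor.actSnd_mk, SourceTarget.ract, map_id_mulLeft]
    exact this
  -- Δ_L and Δ_{L'} share the representatives `evalComul w`; the two mixed laws differ only in the
  -- order of the two maps.
  coassoc_left := coassoc_of_eval T deg σ _ _ _ (comul_eval T deg σ hT) (hS.Δ'_eval hT) _ _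
  coassoc_right := coassoc_of_eval T deg σ _ _ _ (hS.Δ'_eval hT) (comul_eval T deg σ hT) _ _
  twist_inv := ⟨hS.twistEquiv ν, hS.twistEquiv_tmul ν, fun a => by
    obtain ⟨w, rfl⟩ := eval_surjective T deg σ a
    rw [hS.Δ'_eval, hS.twistEquiv_symm_eval]⟩

end IsAntipode

end ASigma

end

theorem mainTheorem5 {k L G X : Type*} [CommRing k] [Ring L] [Algebra k L] [Group G]
    [Fintype X] [DecidableEq X]
    (T : G → L ≃ₐ[k] L) (hT : ∀ α f, T α (T α⁻¹ f) = f) (deg : X → G)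
    (σ : X → X → X → X → L)
    (hσ : ASigma.RightCondition T deg σ) (hrigid : ASigma.Rigid T deg σ) :
    (∃ S : ASigma T deg σ ≃ₐ[k] (ASigma T deg σ)ᵐᵒᵖ, ASigma.IsAntipode T deg σ S) ∧
    ∀ S : ASigma T deg σ ≃ₐ[k] (ASigma T deg σ)ᵐᵒᵖ, ASigma.IsAntipode T deg σ S →
      ∀ {L' : Type*} [Ring L'] (ν : Lᵐᵒᵖ ≃+* L'),
        IsHopfAlgebroid (ASigma.sourceTarget T deg σ) (ASigma.comul T deg σ hT)
          (ASigma.counit T deg σ hT (hσ.left hT)) S ν :=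
  ⟨hrigid.exists_isAntipode hT hσ, fun _ hS _ _ _ => hS.isHopfAlgebroid hT (hσ.left hT)⟩
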